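/- Let $\mathcal H$ be a complex Hilbert space and let $V\subseteq\mathcal H$ be a standard subspace, i.e. a closed real subspace with $V\cap iV=\{0\}$ and $\overline{V+iV}=\mathcal H$. Let $\sigma_V\colon V+iV\to\mathcal H$, $x+iy\mapsto x-iy$ $(x,y\in V)$, be its Tomita operator, let $\Delta_V=\sigma_V^*\sigma_V$ be the modular operator, and let $J_V$ be the modular conjugation, i.e. the antiunitary operator in the polar decomposition $\sigma_V=J_V\Delta_V^{1/2}$. The unitary operators $\Delta_V^{it}$ $(t\in\mathbb R)$ are defined by the functional calculus of the positive self-adjoint operator $\Delta_V$. Then for every bounded operator $A\in B(\mathcal H)$ the following are equivalent: 1. $AV\subseteq V$ and $A$ commutes with $\Delta_V^{it}$ for all $t\in\mathbb R$; 2. $AV\subseteq V$ and $A$ commutes with $J_V$; 3. $A$ commutes with $J_V$ and with $\Delta_V^{it}$ for all $t\in\mathbb R$. Moreover, let $S_V=\{g\in \mathrm U(\mathcal H): gV\subseteq V\}$ and let $\mathrm U(\mathcal H)_V=\{g\in\mathrm U(\mathcal H): gV=V\}$. Then $\mathrm U(\mathcal H)_V$ is the group of units of the monoid $S_V$, and $$\mathrm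 U(\mathcal H)_V=\{g\in S_V: g\Delta_V g^{-1}=\Delta_V\}=\{g\in S_V: gJ_Vg^{-1}=J_V\}.$$ -/

import Mathlib

noncomputable section

namespace StandardModular

/-! ### Antilinear partially defined operators -/

section Antilinear

variable {H : Type*} [NormedAddCommGroup H] [InnerProductSpace ℂ H]

/-- The adjoint `T*` of a densely defined antilinear operator `T`: a vector `u` lies in its domain
iff there is `w` with `⟪u, T z⟫ = ⟪z, w⟫` for all `z` in the domain of `T`, and then `T* u = w`
(which is unique, because the domain of `T` is dense). -/
def antiAdjoint (T : H →ₛₗ.[starRingEnd ℂ] H) (hT : Dense (T.domain : Set H)) :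
    H →ₛₗ.[starRingEnd ℂ] H where
  domain :=
    { carrier := {u | ∃ w : H, ∀ z : T.domain, inner ℂ u (T z) = inner ℂ (z : H) w}
      zero_mem' := ⟨0, by simp⟩
      add_mem' := by
        rintro u v ⟨w, hw⟩ ⟨w', hw'⟩
        exact ⟨w + w', fun z => by rw [inner_add_left, inner_add_right, hw, hw']⟩
      smul_mem' := by
        rintro c u ⟨w, hw⟩
        exact ⟨starRingEnd ℂ c • w, fun z => by
          rw [inner_smul_left, inner_smul_right, hw]⟩ }
  toFun :=
    { toFun := fun u => u.2.choose
      map_add' := fun u v => hT.eq_of_inner_right ℂ fun z hz => by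
        have h1 := u.2.choose_spec ⟨z, hz⟩
        have h2 := v.2.choose_spec ⟨z, hz⟩
        have h3 := (u + v).2.choose_spec ⟨z, hz⟩
        rw [inner_add_right]
        exact (h3.symm.trans (inner_add_left (u : H) (v : H) _)).trans
          (congrArg₂ (· + ·) h1 h2)
      map_smul' := fun c u => hT.eq_of_inner_right ℂ fun z hz => by
        have h1 := u.2.choose_spec ⟨z, hz⟩
        have h3 := (c • u).2.choose_spec ⟨z, hz⟩
        rw [inner_smul_right]
        exact (h3.symm.trans (inner_smul_left (u : H) _ c)).trans
          (congrArg (starRingEnd ℂ c * ·) h1) }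

theorem mem_antiAdjoint_domain_iff {T : H →ₛₗ.[starRingEnd ℂ] H}
    {hT : Dense (T.domain : Set H)} {u : H} :
    u ∈ (antiAdjoint T hT).domain ↔
      ∃ w : H, ∀ z : T.domain, inner ℂ u (T z) = inner ℂ (z : H) w := Iff.rfl

theorem inner_antiAdjoint {T : H →ₛₗ.[starRingEnd ℂ] H} {hT : Dense (T.domain : Set H)}
    (u : (antiAdjoint T hT).domain) (z : T.domain) :
    inner ℂ (u : H) (T z) = inner ℂ (z : H) (antiAdjoint T hT u) :=
  u.2.choose_spec z

/-- The composition `S ∘ T` of two antilinear partially defined operators, with its maximal domain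
`{x ∈ D(T) | T x ∈ D(S)}`. It is complex linear. -/
def antiComp (S T : H →ₛₗ.[starRingEnd ℂ] H) : H →ₗ.[ℂ] H where
  domain :=
    { carrier := {x | ∃ hx : x ∈ T.domain, T ⟨x, hx⟩ ∈ S.domain}
      zero_mem' := ⟨T.domain.zero_mem, by
        have h : T ⟨0, T.domain.zero_mem⟩ = 0 := T.map_zero
        rw [h]; exact S.domain.zero_mem⟩
      add_mem' := by
        rintro x y ⟨hx, hx'⟩ ⟨hy, hy'⟩
        refine ⟨T.domain.add_mem hx hy, ?_⟩
        have h : T ⟨x + y, T.domain.add_mem hx hy⟩ = T ⟨x, hx⟩ + T ⟨y, hy⟩ :=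
          T.map_add ⟨x, hx⟩ ⟨y, hy⟩
        rw [h]; exact S.domain.add_mem hx' hy'
      smul_mem' := by
        rintro c x ⟨hx, hx'⟩
        refine ⟨T.domain.smul_mem c hx, ?_⟩
        have h : T ⟨c • x, T.domain.smul_mem c hx⟩ = starRingEnd ℂ c • T ⟨x, hx⟩ :=
          T.toFun.map_smulₛₗ c ⟨x, hx⟩
        rw [h]; exact S.domain.smul_mem _ hx' }
  toFun :=
    { toFun := fun x => S ⟨T ⟨x, x.2.choose⟩, x.2.choose_spec⟩
      map_add' := fun x y => by
        rw [← S.map_add]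
        congr 1
        exact Subtype.ext (T.map_add ⟨x, x.2.choose⟩ ⟨y, y.2.choose⟩)
      map_smul' := fun c x => by
        have h : S (starRingEnd ℂ c • ⟨T ⟨x, x.2.choose⟩, x.2.choose_spec⟩)
            = c • S ⟨T ⟨x, x.2.choose⟩, x.2.choose_spec⟩ := by
          have := S.toFun.map_smulₛₗ (starRingEnd ℂ c)
            ⟨T ⟨x, x.2.choose⟩, x.2.choose_spec⟩
          rw [Complex.conj_conj] at this
          exact this
        rw [RingHom.id_apply, ← h]
        congr 1
        exact Subtype.ext (T.toFun.map_smulₛₗ c ⟨x, x.2.choose⟩) }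

theorem mem_antiComp_domain_iff {S T : H →ₛₗ.[starRingEnd ℂ] H} {x : H} :
    x ∈ (antiComp S T).domain ↔ ∃ hx : x ∈ T.domain, T ⟨x, hx⟩ ∈ S.domain := Iff.rfl

theorem antiComp_apply {S T : H →ₛₗ.[starRingEnd ℂ] H} {x : H} (hx : x ∈ T.domain)
    (hx' : T ⟨x, hx⟩ ∈ S.domain) :
    antiComp S T ⟨x, hx, hx'⟩ = S ⟨T ⟨x, hx⟩, hx'⟩ := rfl

end Antilinear

/-! ### The Tomita operator and the modular operator of a standard subspace -/

section Tomita

variable {H : Type*} [NormedAddCommGroup H] [InnerProductSpace ℂ H]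

theorem eq_zero_of_mem_of_I_smul_mem (V : StandardSubspace H) {x : H}
    (hx : x ∈ V.toClosedSubmodule) (hx' : Complex.I • x ∈ V.toClosedSubmodule) : x = 0 := by
  have h : x ∈ V.toClosedSubmodule ⊓ V.toClosedSubmodule.mulI := by
    refine ⟨hx, ?_⟩
    have h2 : x ∈ V.toClosedSubmodule.mulI := by
      rw [ClosedSubmodule.mem_mapEquiv_iff, scalarSMulCLE_symm_apply]
      have h3 : (Complex.UnitI⁻¹ • x : H) = -(Complex.I • x) := by
        simp [Units.smul_def]
      rw [h3]
      exact V.toClosedSubmodule.toSubmodule.neg_mem hx'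
    exact h2
  rw [V.IsSeparating] at h
  exact h

theorem decomposition_unique (V : StandardSubspace H) {x y x' y' : H}
    (hx : x ∈ V.toClosedSubmodule) (hy : y ∈ V.toClosedSubmodule)
    (hx' : x' ∈ V.toClosedSubmodule) (hy' : y' ∈ V.toClosedSubmodule)
    (h : x + Complex.I • y = x' + Complex.I • y') : x = x' ∧ y = y' := by
  have h1 : Complex.I • (y' - y) = x - x' := by
    rw [smul_sub, sub_eq_sub_iff_add_eq_add, add_comm, ← h]
  have h2 : y' - y = 0 := eq_zero_of_mem_of_I_smul_mem V
    (V.toClosedSubmodule.toSubmodule.sub_mem hy' hy)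
    (h1 ▸ V.toClosedSubmodule.toSubmodule.sub_mem hx hx')
  have h3 : y = y' := (sub_eq_zero.mp h2).symm
  refine ⟨?_, h3⟩
  rw [h2, smul_zero] at h1
  exact (sub_eq_zero.mp h1.symm)

/-- The complex subspace `V + iV`. -/
def complexSpan (V : StandardSubspace H) : Submodule ℂ H where
  carrier := {z | ∃ x ∈ V.toClosedSubmodule, ∃ y ∈ V.toClosedSubmodule, z = x + Complex.I • y}
  zero_mem' := ⟨0, V.toClosedSubmodule.toSubmodule.zero_mem, 0,
    V.toClosedSubmodule.toSubmodule.zero_mem, by simp⟩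
  add_mem' := by
    rintro _ _ ⟨x, hx, y, hy, rfl⟩ ⟨x', hx', y', hy', rfl⟩
    exact ⟨x + x', V.toClosedSubmodule.toSubmodule.add_mem hx hx', y + y',
      V.toClosedSubmodule.toSubmodule.add_mem hy hy', by rw [smul_add]; abel⟩
  smul_mem' := by
    rintro c _ ⟨x, hx, y, hy, rfl⟩
    refine ⟨c.re • x - c.im • y, V.toClosedSubmodule.toSubmodule.sub_mem
      (V.toClosedSubmodule.toSubmodule.smul_mem _ hx)
      (V.toClosedSubmodule.toSubmodule.smul_mem _ hy), c.re • y + c.im • x,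
      V.toClosedSubmodule.toSubmodule.add_mem
      (V.toClosedSubmodule.toSubmodule.smul_mem _ hy)
      (V.toClosedSubmodule.toSubmodule.smul_mem _ hx), ?_⟩
    have hI (v : H) : Complex.I • Complex.I • v = -v := by
      rw [smul_smul, Complex.I_mul_I, neg_one_smul]
    have hc (v : H) : c • v = c.re • v + Complex.I • c.im • v := by
      conv_lhs => rw [← Complex.re_add_im c]
      rw [add_smul, mul_comm, mul_smul, Complex.coe_smul, Complex.coe_smul]
    rw [hc, smul_add, smul_add, smul_add, smul_add, smul_comm c.im Complex.I y, hI,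
      smul_comm c.re Complex.I y]
    abel

theorem mem_complexSpan_iff {V : StandardSubspace H} {z : H} :
    z ∈ complexSpan V ↔ ∃ x ∈ V.toClosedSubmodule, ∃ y ∈ V.toClosedSubmodule,
      z = x + Complex.I • y := Iff.rfl

theorem dense_complexSpan (V : StandardSubspace H) : Dense (complexSpan V : Set H) := by
  have h : closure ((V.toClosedSubmodule.toSubmodule ⊔
      V.toClosedSubmodule.mulI.toSubmodule : Submodule ℝ H) : Set H) = Set.univ := by
    have h := congrArg (fun S : ClosedSubmodule ℝ H => (S : Set H)) V.IsCyclic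
    simpa using h
  rw [dense_iff_closure_eq, ← Set.univ_subset_iff, ← h]
  refine closure_mono fun z hz => ?_
  obtain ⟨x, hx, y, hy, rfl⟩ := Submodule.mem_sup.mp hz
  have hy' : y ∈ V.toClosedSubmodule.mulI := hy
  rw [ClosedSubmodule.mem_mapEquiv_iff, scalarSMulCLE_symm_apply] at hy'
  refine ⟨x, hx, _, hy', ?_⟩
  simp [Units.smul_def, smul_smul]

/-- The conjugate `x - iy` of a vector `x + iy ∈ V + iV`. -/
def tomitaFun (V : StandardSubspace H) (z : complexSpan V) : H :=
  z.2.choose - Complex.I • z.2.choose_spec.2.choose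

theorem tomitaFun_eq (V : StandardSubspace H) {x y : H} (hx : x ∈ V.toClosedSubmodule)
    (hy : y ∈ V.toClosedSubmodule) (z : complexSpan V) (hz : (z : H) = x + Complex.I • y) :
    tomitaFun V z = x - Complex.I • y := by
  have h1 := z.2.choose_spec.1
  have h2 := z.2.choose_spec.2.choose_spec
  obtain ⟨e1, e2⟩ := decomposition_unique V h1 h2.1 hx hy (h2.2.symm.trans hz)
  exact congrArg₂ (fun a b : H => a - Complex.I • b) e1 e2

/-- The Tomita operator `σ_V : V + iV → H`, `x + iy ↦ x - iy` for `x, y ∈ V`. -/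
def tomita (V : StandardSubspace H) : H →ₛₗ.[starRingEnd ℂ] H where
  domain := complexSpan V
  toFun :=
    { toFun := tomitaFun V
      map_add' := by
        intro z w
        obtain ⟨x, hx, y, hy, hz⟩ := z.2
        obtain ⟨x', hx', y', hy', hw⟩ := w.2
        rw [tomitaFun_eq V hx hy z hz, tomitaFun_eq V hx' hy' w hw,
          tomitaFun_eq V (V.toClosedSubmodule.toSubmodule.add_mem hx hx')
            (V.toClosedSubmodule.toSubmodule.add_mem hy hy') (z + w)
            (by rw [Submodule.coe_add, hz, hw, smul_add]; abel)]
        rw [smul_add]; abel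
      map_smul' := by
        intro c z
        obtain ⟨x, hx, y, hy, hz⟩ := z.2
        have hI (v : H) : Complex.I • Complex.I • v = -v := by
          rw [smul_smul, Complex.I_mul_I, neg_one_smul]
        have hc (v : H) : c • v = c.re • v + Complex.I • c.im • v := by
          conv_lhs => rw [← Complex.re_add_im c]
          rw [add_smul, mul_comm, mul_smul, Complex.coe_smul, Complex.coe_smul]
        have hc' (v : H) : starRingEnd ℂ c • v = c.re • v - Complex.I • c.im • v := by
          conv_lhs => rw [← Complex.re_add_im (starRingEnd ℂ c)]
          rw [add_smul, mul_comm, mul_smul, Complex.coe_smul, Complex.coe_smul, Complex.conj_re,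
            Complex.conj_im, neg_smul, smul_neg, sub_eq_add_neg]
        rw [tomitaFun_eq V hx hy z hz,
          tomitaFun_eq V (x := c.re • x - c.im • y) (y := c.re • y + c.im • x)
            (V.toClosedSubmodule.toSubmodule.sub_mem
              (V.toClosedSubmodule.toSubmodule.smul_mem _ hx)
              (V.toClosedSubmodule.toSubmodule.smul_mem _ hy))
            (V.toClosedSubmodule.toSubmodule.add_mem
              (V.toClosedSubmodule.toSubmodule.smul_mem _ hy)
              (V.toClosedSubmodule.toSubmodule.smul_mem _ hx)) (c • z) ?_]
        · rw [hc', smul_sub, smul_sub, smul_sub, smul_add, smul_comm c.im Complex.I y, hI,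
            smul_comm c.re Complex.I y]
          abel
        · rw [Submodule.coe_smul, hz, hc, smul_add, smul_add, smul_add, smul_add, smul_comm c.im Complex.I y, hI,
            smul_comm c.re Complex.I y]
          abel }

theorem tomita_domain (V : StandardSubspace H) : (tomita V).domain = complexSpan V := rfl

theorem tomita_apply (V : StandardSubspace H) {x y : H} (hx : x ∈ V.toClosedSubmodule)
    (hy : y ∈ V.toClosedSubmodule) (h : x + Complex.I • y ∈ (tomita V).domain) :
    tomita V ⟨x + Complex.I • y, h⟩ = x - Complex.I • y :=
  tomitaFun_eq V hx hy ⟨_, h⟩ rfl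

/-- The modular operator `Δ_V = σ_V* σ_V`. -/
def modularOperator (V : StandardSubspace H) : H →ₗ.[ℂ] H :=
  antiComp (antiAdjoint (tomita V) (dense_complexSpan V)) (tomita V)

end Tomita

/-! ### Spectral measures and functions of a self-adjoint operator -/

section Spectral

/-- A projection-valued (spectral) measure on the Borel sets of `ℝ`. The values on sets that are
not measurable are never used. -/
structure SpectralMeasure (H : Type*) [NormedAddCommGroup H] [InnerProductSpace ℂ H]
    [CompleteSpace H] where
  /-- The projection `E s` of a Borel set `s`. -/
  proj : Set ℝ → H →L[ℂ] H
  isStarProjection : ∀ s, MeasurableSet s → IsStarProjection (proj s)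
  proj_univ : proj Set.univ = 1
  proj_inter : ∀ s t, MeasurableSet s → MeasurableSet t → proj (s ∩ t) = proj s * proj t
  hasSum_proj : ∀ s : ℕ → Set ℝ, (∀ n, MeasurableSet (s n)) →
    Pairwise (Function.onFun Disjoint s) →
    ∀ x, HasSum (fun n => proj (s n) x) (proj (⋃ n, s n) x)

variable {H : Type*} [NormedAddCommGroup H] [InnerProductSpace ℂ H] [CompleteSpace H]

theorem SpectralMeasure.proj_empty (E : SpectralMeasure H) : E.proj ∅ = 0 := by
  ext x
  have h := E.hasSum_proj (fun _ => ∅) (fun _ => MeasurableSet.empty)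
    (fun _ _ _ => by simp [Function.onFun]) x
  simpa using tendsto_nhds_unique tendsto_const_nhds h.summable.tendsto_atTop_zero

theorem SpectralMeasure.re_inner_proj_nonneg (E : SpectralMeasure H) {s : Set ℝ}
    (hs : MeasurableSet s) (x : H) : 0 ≤ (inner ℂ x (E.proj s x)).re := by
  have h := E.isStarProjection s hs
  have h1 : E.proj s x = E.proj s (E.proj s x) := by
    conv_lhs => rw [← h.isIdempotentElem.eq]
    rfl
  rw [h1, ← ContinuousLinearMap.adjoint_inner_left, ← ContinuousLinearMap.star_eq_adjoint,
    h.isSelfAdjoint.star_eq]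
  exact inner_self_nonneg (𝕜 := ℂ)

/-- The finite positive measure `μ_x(s) = ⟪x, E(s) x⟫` on `ℝ`. -/
def SpectralMeasure.measure (E : SpectralMeasure H) (x : H) : MeasureTheory.Measure ℝ :=
  MeasureTheory.Measure.ofMeasurable
    (fun s _ => ENNReal.ofReal (inner ℂ x (E.proj s x)).re)
    (by rw [E.proj_empty]; simp)
    (by
      intro s hs hd
      have h := E.hasSum_proj s hs hd x
      have h2 : HasSum (fun n => (inner ℂ x (E.proj (s n) x)).re)
          (inner ℂ x (E.proj (⋃ n, s n) x)).re :=
        Complex.hasSum_re (h.mapL (innerSL ℂ x))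
      rw [← h2.tsum_eq, ENNReal.ofReal_tsum_of_nonneg
        (fun n => E.re_inner_proj_nonneg (hs n) x) h2.summable])

theorem SpectralMeasure.measure_apply (E : SpectralMeasure H) (x : H) {s : Set ℝ}
    (hs : MeasurableSet s) :
    E.measure x s = ENNReal.ofReal (inner ℂ x (E.proj s x)).re :=
  MeasureTheory.Measure.ofMeasurable_apply s hs

/-- `E` is the spectral measure of the self-adjoint operator `T`, that is `T = ∫ r dE(r)`: the
domain of `T` consists of the vectors `x` with `∫ r² dμ_x(r) < ∞`, and
`⟪x, T x⟫ = ∫ r dμ_x(r)` for these `x`. -/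
def SpectralMeasure.Represents (E : SpectralMeasure H) (T : H →ₗ.[ℂ] H) : Prop :=
  (∀ x : H, x ∈ T.domain ↔ MeasureTheory.Integrable (fun r : ℝ => r ^ 2) (E.measure x)) ∧
  ∀ x : T.domain, inner ℂ (x : H) (T x) = ∫ r : ℝ, (r : ℂ) ∂(E.measure (x : H))

/-- `U = f(T)` in the sense of the spectral theorem, for a bounded operator `U`:
`U = ∫ f(r) dE(r)` for the spectral measure `E` of `T`, that is `⟪x, U x⟫ = ∫ f dμ_x`
for all `x`. -/
def IsFunctionOf (T : H →ₗ.[ℂ] H) (f : ℝ → ℂ) (U : H →L[ℂ] H) : Prop :=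
  ∃ E : SpectralMeasure H, E.Represents T ∧ ∀ x : H,
    MeasureTheory.Integrable f (E.measure x) ∧ inner ℂ x (U x) = ∫ r : ℝ, f r ∂(E.measure x)

open Classical in
/-- The bounded operator `f(T)`, for a self-adjoint operator `T` and a bounded Borel function `f`
(it exists and is unique by the spectral theorem; the value is `0` where there is none). -/
def functionOf (T : H →ₗ.[ℂ] H) (f : ℝ → ℂ) : H →L[ℂ] H :=
  if h : ∃ U, IsFunctionOf T f U then h.choose else 0

/-- `S` is the positive self-adjoint square root of `T`: it is positive and self-adjoint, and
`S ∘ S = T` including equality of domains. -/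
def IsPositiveSqrt (S T : H →ₗ.[ℂ] H) : Prop :=
  IsSelfAdjoint S ∧ (∀ x : S.domain, 0 ≤ (inner ℂ (x : H) (S x)).re) ∧
  ∀ x y : H, (x, y) ∈ T.graph ↔ ∃ z, (x, z) ∈ S.graph ∧ (z, y) ∈ S.graph

/-- The operator `g T g⁻¹` with domain `g D(T)`, for a unitary operator `g`. -/
def unitaryConj (g : unitary (H →L[ℂ] H)) (T : H →ₗ.[ℂ] H) : H →ₗ.[ℂ] H where
  domain := T.domain.comap ((g⁻¹ : unitary (H →L[ℂ] H)) : H →L[ℂ] H).toLinearMap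
  toFun := (g : H →L[ℂ] H).toLinearMap ∘ₗ T.toFun ∘ₗ
    ((g⁻¹ : unitary (H →L[ℂ] H)) : H →L[ℂ] H).toLinearMap.restrict (fun _ h => h)

end Spectral

/-! ### Modular objects -/

section Modular

variable {H : Type*} [NormedAddCommGroup H] [InnerProductSpace ℂ H] [CompleteSpace H]

/-- The unitary operator `Δ_V^{it}`. -/
def modularUnitary (V : StandardSubspace H) (t : ℝ) : H →L[ℂ] H :=
  functionOf (modularOperator V) (fun r => (r : ℂ) ^ ((t : ℂ) * Complex.I))

/-- `J` is the antiunitary operator in the polar decomposition `σ_V = J Δ_V^{1/2}`. -/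
def IsModularConjugation (V : StandardSubspace H) (J : H →L⋆[ℂ] H) : Prop :=
  Isometry J ∧ Function.Surjective J ∧
  ∃ S : H →ₗ.[ℂ] H, IsPositiveSqrt S (modularOperator V) ∧
    (∀ x, x ∈ S.domain ↔ x ∈ (tomita V).domain) ∧
    ∀ (x : H) (h : x ∈ S.domain) (h' : x ∈ (tomita V).domain),
      tomita V ⟨x, h'⟩ = J (S ⟨x, h⟩)

open Classical in
/-- The modular conjugation `J_V`, given by the polar decomposition `σ_V = J_V Δ_V^{1/2}`
(it exists and is unique; the value is `0` where there is none). -/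
def modularConjugation (V : StandardSubspace H) : H →L⋆[ℂ] H :=
  if h : ∃ J, IsModularConjugation V J then h.choose else 0

/-- The real subspace `V` is mapped into itself by `A`. -/
def Preserves (A : H →L[ℂ] H) (V : StandardSubspace H) : Prop :=
  ∀ x ∈ V.toClosedSubmodule, A x ∈ V.toClosedSubmodule

/-- The bounded operator `A` commutes with all `Δ_V^{it}`, `t ∈ ℝ`. -/
def CommutesWithModularGroup (A : H →L[ℂ] H) (V : StandardSubspace H) : Prop :=
  ∀ t : ℝ, Commute A (modularUnitary V t)

/-- The bounded operator `A` commutes with `J_V`. -/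
def CommutesWithConjugation (A : H →L[ℂ] H) (V : StandardSubspace H) : Prop :=
  ∀ x : H, A (modularConjugation V x) = modularConjugation V (A x)

/-- The semigroup `S_V` of unitary operators `g` with `g V ⊆ V`. -/
def unitaryEndomorphisms (V : StandardSubspace H) : Submonoid (unitary (H →L[ℂ] H)) where
  carrier := {g | Preserves (g : H →L[ℂ] H) V}
  one_mem' := fun _ hx => hx
  mul_mem' := fun ha hb x hx => ha _ (hb x hx)

/-- The stabilizer `U(H)_V` of unitary operators `g` with `g V = V`. -/
def unitaryStabilizer (V : StandardSubspace H) : Set (unitary (H →L[ℂ] H)) :=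
  {g | (fun x => (g : H →L[ℂ] H) x) '' (V.toClosedSubmodule : Set H)
    = (V.toClosedSubmodule : Set H)}

end Modular

end StandardModular

end

/-! ### Linear and antilinear parts of a real orthogonal projection -/

namespace StandardModular

section ModularPair

variable {H : Type*} [NormedAddCommGroup H] [InnerProductSpace ℂ H]

/-! All unbounded objects are replaced by bounded ones. Let `P` be the real orthogonal projection
onto `V`, and write `P = C + D` with `C` complex linear and `D` antilinear. Separating types in `P²
= P` gives `C² + D² = C` and `CD + DC = D`; since `V` is separating and cyclic, `0 ≤ C ≤ 1` with `C`
and `1 - C` injective. Put `a = C^{1/2}` and `b = (1 - C)^{1/2}`. Then `D² = (ab)²`, and the polar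
decomposition `D = J ab` yields an antiunitary involution with `J a = b J`. These data
(`BoundedModularData`) encode everything: `x ∈ V` iff `a J x = b x`, the Tomita operator is `a y ↦ J
b y`, and the graphs of `Δ_V` and `Δ_V^{1/2}` are `{(a² y, b² y)}` and `{(a y, b y)}`. In particular
`J = J_V` and `a² = (1 + Δ_V)⁻¹`.

Commuting with all `Δ_V^{it}` is equivalent to commuting with `a²` (`commute_iff`), and the
equivalence of the three conditions becomes algebra. If `A` commutes with `a²`, hence with `a` and
`b`, the equation `a J x = b x` shows that `AJ - JA` vanishes on `V` when `A` preserves `V`, and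
that `A` preserves `V` when it commutes with `J`. If `A` preserves `V` and commutes with `J`, then
`aAb = bAa`; hence `a² A b² = b² A a²`, and `b² = 1 - a²` turns this into `a² A = A a²`.

The analytic work lies in `commute_iff`, because the `Δ_V^{it}` are defined through an unspecified
spectral measure. A spectral measure with `∫ (1 + r)⁻¹ dE = a²` is built from the continuous
functional calculus and the Riesz-Markov theorem. Representing `Δ_V` is equivalent to having this
resolvent, and the moments of `(1 + r)⁻¹` determine the measures. A bounded operator in the
commutant of a star-closed set is a combination of four unitaries there, so only unitaries `g`
matter; for them commutation means invariance of quadratic forms, that is `μ_{gx} = μ_x`. This can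
be tested on moments or on the characteristic function of the distribution of `log r`, which is `⟪x,
Δ_V^{it} x⟫`.

For the last assertions, `gV = V` makes both `g` and `g⁻¹` commute with the Tomita operator, hence
`g` with its adjoint and with `Δ_V`. -/

theorem smul_eq_re_add_im (c : ℂ) (v : H) : c • v = c.re • v + c.im • Complex.I • v := by
  conv_lhs => rw [← Complex.re_add_im c]
  rw [add_smul, mul_smul, Complex.coe_smul, Complex.coe_smul]

theorem conj_smul_eq_re_sub_im (c : ℂ) (v : H) :
    starRingEnd ℂ c • v = c.re • v - c.im • Complex.I • v := by
  rw [smul_eq_re_add_im, Complex.conj_re, Complex.conj_im, neg_smul, sub_eq_add_neg]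

theorem I_smul_I_smul (v : H) : Complex.I • Complex.I • v = -v := by
  rw [smul_smul, Complex.I_mul_I, neg_one_smul]

open ClosedSubmodule in
theorem exists_real_projection [CompleteSpace H] (V : ClosedSubmodule ℝ H) :
    ∃ P : H →L[ℝ] H, (∀ x, P x ∈ V) ∧ (∀ x ∈ V, P x = x) ∧
      ∀ x y, (inner ℂ (P x) y).re = (inner ℂ x (P y)).re := by
  have : CompleteSpace V.toSubmodule := V.isClosed.completeSpace_coe
  refine ⟨V.toSubmodule.starProjection, fun x => ?_, fun x hx => ?_, fun x y => ?_⟩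
  · exact V.toSubmodule.starProjection_apply_mem x
  · exact Submodule.starProjection_eq_self_iff.mpr hx
  · exact V.toSubmodule.inner_starProjection_left_eq_right x y

/-- The complex linear part of a real linear operator. -/
noncomputable def linearPart (P : H →L[ℝ] H) : H →L[ℂ] H where
  toFun x := (2⁻¹ : ℝ) • (P x - Complex.I • P (Complex.I • x))
  map_add' x y := by
    simp only [smul_add, map_add, smul_sub]; abel
  map_smul' c x := by
    simp only [RingHom.id_apply]
    rw [smul_eq_re_add_im c x, smul_eq_re_add_im c]
    simp only [smul_add, map_add, map_smul, smul_sub, smul_comm Complex.I (_ : ℝ), map_neg,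
      I_smul_I_smul, smul_neg, smul_comm (2⁻¹ : ℝ) (_ : ℝ)]
    abel
  cont := by fun_prop

/-- The antilinear part of a real linear operator. -/
noncomputable def antilinearPart (P : H →L[ℝ] H) : H →L⋆[ℂ] H where
  toFun x := (2⁻¹ : ℝ) • (P x + Complex.I • P (Complex.I • x))
  map_add' x y := by
    simp only [smul_add, map_add]; abel
  map_smul' c x := by
    rw [smul_eq_re_add_im c x, conj_smul_eq_re_sub_im c]
    simp only [smul_add, map_add, map_smul, smul_comm Complex.I (_ : ℝ), map_neg,
      I_smul_I_smul, smul_neg, smul_comm (2⁻¹ : ℝ) (_ : ℝ)]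
    abel
  cont := by fun_prop

theorem linearPart_apply (P : H →L[ℝ] H) (x : H) :
    linearPart P x = (2⁻¹ : ℝ) • (P x - Complex.I • P (Complex.I • x)) := rfl

theorem antilinearPart_apply (P : H →L[ℝ] H) (x : H) :
    antilinearPart P x = (2⁻¹ : ℝ) • (P x + Complex.I • P (Complex.I • x)) := rfl

theorem linearPart_add_antilinearPart (P : H →L[ℝ] H) (x : H) :
    linearPart P x + antilinearPart P x = P x := by
  rw [linearPart_apply, antilinearPart_apply, ← smul_add]
  rw [show P x - Complex.I • P (Complex.I • x) + (P x + Complex.I • P (Complex.I • x))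
    = (2 : ℝ) • P x by rw [two_smul]; abel, smul_smul]
  norm_num

/-- Separates the two types: evaluating an identity of real linear maps at `i z` leaves the linear
part multiplied by `i` and the antilinear part by `-i`. -/
theorem eq_of_linear_add_antilinear {x y x' y' : H} (h : x + y = x' + y')
    (h' : Complex.I • x - Complex.I • y = Complex.I • x' - Complex.I • y') :
    x = x' ∧ y = y' := by
  rw [← smul_sub, ← smul_sub] at h'
  have h2 : x - y = x' - y' := smul_right_injective H Complex.I_ne_zero h'
  have h3 : (2 : ℝ) • x = (2 : ℝ) • x' := by
    rw [two_smul, two_smul]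
    calc x + x = (x + y) + (x - y) := by abel
      _ = x' + x' := by rw [h, h2]; abel
  have h4 : x = x' := smul_right_injective H (two_ne_zero (α := ℝ)) h3
  exact ⟨h4, by rw [h4] at h; exact add_left_cancel h⟩

section Idempotent

variable {P : H →L[ℝ] H} (hP : ∀ x, P (P x) = P x)
include hP

theorem parts_of_idempotent (x : H) :
    linearPart P (linearPart P x) + antilinearPart P (antilinearPart P x) = linearPart P x ∧
    linearPart P (antilinearPart P x) + antilinearPart P (linearPart P x) =
      antilinearPart P x := by
  set C := linearPart P
  set D := antilinearPart P
  have key (z : H) : C (C z) + D (D z) + (C (D z) + D (C z)) = C z + D z := by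
    have h := hP z
    simp only [← linearPart_add_antilinearPart P, map_add] at h
    rw [← h]; abel
  refine eq_of_linear_add_antilinear (key x) ?_
  have h := key (Complex.I • x)
  simp only [map_smul, map_smulₛₗ, Complex.conj_I, neg_smul, map_neg,
    neg_neg] at h
  rw [smul_add, smul_add]
  convert h using 1 <;> abel

end Idempotent

section Symmetric

variable {P : H →L[ℝ] H} (hP : ∀ x y, (inner ℂ (P x) y).re = (inner ℂ x (P y)).re)
include hP

theorem inner_linearPart_symm (x y : H) :
    inner ℂ (linearPart P x) y = inner ℂ x (linearPart P y) := by
  have hre (x y : H) :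
      (inner ℂ (linearPart P x) y).re = (inner ℂ x (linearPart P y)).re := by
    have h1 := hP x y
    have h2 := hP (Complex.I • x) (Complex.I • y)
    simp only [linearPart_apply, inner_smul_left, inner_smul_right, inner_sub_left,
      inner_sub_right, RCLike.real_smul_eq_coe_smul (K := ℂ)] at h1 h2 ⊢
    simp only [Complex.mul_re, Complex.sub_re, Complex.conj_I, Complex.neg_re, Complex.I_re,
      Complex.I_im, Complex.neg_im, Complex.conj_ofReal,
      RCLike.ofReal_alg, Complex.real_smul, Complex.mul_im, Complex.ofReal_re, Complex.ofReal_im,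
      Complex.one_re, Complex.one_im, map_mul, map_one, Complex.sub_im] at h1 h2 ⊢
    linarith
  refine Complex.ext (hre x y) ?_
  have h := hre x (Complex.I • y)
  simp only [map_smul, inner_smul_right, Complex.mul_re, Complex.I_re, Complex.I_im] at h
  linarith

/-- The real parts agree because `D = P - C` is a difference of symmetric real operators; replacing
`y` by `i y` then gives the imaginary parts. -/
theorem inner_antilinearPart_symm (x y : H) :
    inner ℂ x (antilinearPart P y) = inner ℂ y (antilinearPart P x) := by
  have hre (x y : H) :
      (inner ℂ x (antilinearPart P y)).re = (inner ℂ y (antilinearPart P x)).re := by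
    rw [← inner_conj_symm y, Complex.conj_re]
    have h1 := hP x y
    have h2 := hP (Complex.I • x) (Complex.I • y)
    have h3 : linearPart P x + antilinearPart P x = P x := linearPart_add_antilinearPart P x
    have h4 := linearPart_add_antilinearPart P y
    rw [← h3, ← h4, inner_add_left, inner_add_right, Complex.add_re, Complex.add_re,
      inner_linearPart_symm hP] at h1
    linarith
  refine Complex.ext (hre x y) ?_
  have h := hre x (Complex.I • y)
  simp only [map_smulₛₗ, inner_smul_right, inner_smul_left, Complex.mul_re, Complex.I_re,
    Complex.I_im, Complex.conj_I, Complex.neg_re, Complex.neg_im] at h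
  linarith

end Symmetric

end ModularPair

end StandardModular

/-! ### Antiunitary polar decomposition -/

namespace StandardModular

section Antiunitary

variable {H : Type*} [NormedAddCommGroup H] [InnerProductSpace ℂ H]

theorem nonneg_of_inner {A : H →L[ℂ] H} (hs : ∀ x y, inner ℂ (A x) y = inner ℂ x (A y))
    (hp : ∀ x, 0 ≤ (inner ℂ x (A x)).re) : 0 ≤ A := by
  rw [ContinuousLinearMap.nonneg_iff_isPositive, ContinuousLinearMap.isPositive_def]
  refine ⟨hs, fun x => ?_⟩
  rw [ContinuousLinearMap.reApplyInnerSelf_apply, hs]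
  exact hp x

theorem inner_symm_of_nonneg {A : H →L[ℂ] H} (hA : 0 ≤ A) (x y : H) :
    inner ℂ (A x) y = inner ℂ x (A y) :=
  ((ContinuousLinearMap.nonneg_iff_isPositive A).mp hA).inner_left_eq_inner_right x y

theorem re_inner_nonneg_of_nonneg {A : H →L[ℂ] H} (hA : 0 ≤ A) (x : H) :
    0 ≤ (inner ℂ x (A x)).re :=
  ((ContinuousLinearMap.nonneg_iff_isPositive A).mp hA).re_inner_nonneg_right x

theorem denseRange_of_inner_symm_of_injective [CompleteSpace H] {A : H →L[ℂ] H}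
    (hs : ∀ x y, inner ℂ (A x) y = inner ℂ x (A y)) (hA : ∀ x, A x = 0 → x = 0) :
    DenseRange A := by
  have h : Dense ((LinearMap.range A.toLinearMap : Submodule ℂ H) : Set H) := by
    rw [Submodule.dense_iff_topologicalClosure_eq_top, Submodule.topologicalClosure_eq_top_iff,
      Submodule.eq_bot_iff]
    intro x hx
    refine hA x (inner_self_eq_zero (𝕜 := ℂ).mp ?_)
    rw [← hs]
    exact (Submodule.mem_orthogonal _ _).mp hx _ ⟨A x, rfl⟩
  exact h

theorem denseRange_antilinear_of_symm_of_injective [CompleteSpace H] {D : H →L⋆[ℂ] H}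
    (hs : ∀ x y, inner ℂ x (D y) = inner ℂ y (D x)) (hD : ∀ x, D x = 0 → x = 0) :
    DenseRange D := by
  have h : Dense ((LinearMap.range D.toLinearMap : Submodule ℂ H) : Set H) := by
    rw [Submodule.dense_iff_topologicalClosure_eq_top, Submodule.topologicalClosure_eq_top_iff,
      Submodule.eq_bot_iff]
    intro x hx
    refine hD x (inner_self_eq_zero (𝕜 := ℂ).mp ?_)
    rw [hs]
    have := (Submodule.mem_orthogonal _ _).mp hx (D (D x)) ⟨D x, rfl⟩
    rw [← inner_conj_symm, this, map_zero]
  exact h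

theorem inner_map_map_of_antilinear {J : H →L⋆[ℂ] H} (hJ : ∀ x, ‖J x‖ = ‖x‖) (x y : H) :
    inner ℂ (J x) (J y) = inner ℂ y x := by
  have hre (x y : H) : (inner ℂ (J x) (J y)).re = (inner ℂ y x).re := by
    have h1 := norm_add_sq (𝕜 := ℂ) (J x) (J y)
    have h2 := norm_add_sq (𝕜 := ℂ) y x
    rw [← map_add, hJ, hJ, hJ, add_comm x y] at h1
    simp only [RCLike.re_to_complex] at h1 h2
    linarith
  refine Complex.ext (hre x y) ?_
  have h := hre x (Complex.I • y)
  simp only [map_smulₛₗ, inner_smul_right, inner_smul_left, Complex.mul_re, Complex.I_re,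
    Complex.I_im, Complex.conj_I, Complex.neg_re, Complex.neg_im] at h
  linarith

theorem antilinear_conj_nonneg {J K : H →L⋆[ℂ] H}
    (hJ : ∀ x y, inner ℂ (J x) (J y) = inner ℂ y x) (hJK : ∀ x, J (K x) = x)
    {A : H →L[ℂ] H} (hA : 0 ≤ A) : 0 ≤ J.comp (A.comp K) := by
  refine nonneg_of_inner (fun x y => ?_) fun x => ?_
  · change inner ℂ (J (A (K x))) y = inner ℂ x (J (A (K y)))
    conv_lhs => rw [← hJK y]
    conv_rhs => rw [← hJK x]
    rw [hJ, hJ, inner_symm_of_nonneg hA]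
  · change 0 ≤ (inner ℂ x (J (A (K x)))).re
    conv => enter [2, 1, 2]; rw [← hJK x]
    rw [hJ, inner_symm_of_nonneg hA]
    exact re_inner_nonneg_of_nonneg hA _

/-- Polar decomposition of an injective antilinear operator `D` with `D² = T²`. -/
theorem exists_antiunitary_polar [CompleteSpace H] {D : H →L⋆[ℂ] H} {T : H →L[ℂ] H}
    (hD : ∀ x y, inner ℂ x (D y) = inner ℂ y (D x)) (hT : 0 ≤ T)
    (hT' : ∀ x, T x = 0 → x = 0) (hDT : ∀ x, D (D x) = T (T x)) :
    ∃ J : H →L⋆[ℂ] H, (∀ x, J (T x) = D x) ∧ (∀ x, ‖J x‖ = ‖x‖) ∧ (∀ x, J (J x) = x) ∧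
      ∀ x, J (T x) = T (J x) := by
  have hTs := inner_symm_of_nonneg hT
  have hTd : DenseRange T := denseRange_of_inner_symm_of_injective hTs hT'
  have hDi (x : H) (hx : D x = 0) : x = 0 :=
    hT' _ (hT' _ (by rw [← hDT, hx, map_zero]))
  have hDd : DenseRange D := denseRange_antilinear_of_symm_of_injective hD hDi
  have hn (x : H) : ‖D x‖ = ‖T x‖ := by
    have h : inner ℂ (D x) (D x) = inner ℂ (T x) (T x) := by
      rw [hD, hDT, hTs]
    rw [inner_self_eq_norm_sq_to_K, inner_self_eq_norm_sq_to_K] at h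
    exact (sq_eq_sq₀ (norm_nonneg _) (norm_nonneg _)).mp (by exact_mod_cast h)
  have hb : ∃ c : ℝ, ∀ x, ‖D.toLinearMap x‖ ≤ c * ‖T.toLinearMap x‖ :=
    ⟨1, fun x => by rw [one_mul]; exact (hn x).le⟩
  -- Equality of the norms of `D x` and `T x` makes `T x ↦ D x` well defined and isometric on the
  -- dense range of `T`.
  set J : H →L⋆[ℂ] H := D.toLinearMap.extendOfNorm T.toLinearMap with hJdef
  have hJT (x : H) : J (T x) = D x := LinearMap.extendOfNorm_eq hTd hb x
  have hJn (x : H) : ‖J x‖ = ‖x‖ := by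
    refine hTd.induction_on (p := fun x => ‖J x‖ = ‖x‖) x
      (isClosed_eq (by fun_prop) (by fun_prop)) fun y => ?_
    rw [hJT, hn]
  have hJi : Isometry J := AddMonoidHomClass.isometry_of_norm J hJn
  have hJs : Function.Surjective J := by
    rw [← Set.range_eq_univ, ← hJi.isClosedEmbedding.isClosed_range.closure_eq]
    refine (hDd.mono ?_).closure_eq
    rintro _ ⟨x, rfl⟩
    exact ⟨T x, hJT x⟩
  have hJin := inner_map_map_of_antilinear hJn
  let e : H ≃ₛₗᵢ[starRingEnd ℂ] H :=
    LinearIsometryEquiv.ofSurjective ⟨J.toLinearMap, hJn⟩ hJs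
  let K : H →L⋆[ℂ] H := e.symm.toContinuousLinearEquiv.toContinuousLinearMap
  have hJK (x : H) : J (K x) = x := e.apply_symm_apply x
  have hKJ (x : H) : K (J x) = x := e.symm_apply_apply x
  have hJTJ (x : H) : J (T (J x)) = T x := by
    refine hTd.induction_on (p := fun x => J (T (J x)) = T x) x
      (isClosed_eq (by fun_prop) (by fun_prop)) fun y => ?_
    rw [hJT y, hJT, hDT]
  -- `J T J⁻¹` is positive with square `T²`, so uniqueness of positive square roots makes `J`
  -- commute with `T`. Then `J T J = T` forces `J² = 1`.
  have hM : J.comp (T.comp K) = T := by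
    refine (CFC.mul_self_eq_mul_self_iff _ _ (antilinear_conj_nonneg hJin hJK hT) hT).mp ?_
    ext x
    change J (T (K (J (T (K x))))) = T (T x)
    rw [hKJ]
    rw [← hJTJ (K x), hJK, hJTJ]
  have hcomm (x : H) : J (T x) = T (J x) := by
    have h := DFunLike.congr_fun hM (J x)
    change J (T (K (J x))) = T (J x) at h
    rwa [hKJ] at h
  refine ⟨J, hJT, hJn, fun x => ?_, hcomm⟩
  refine hTd.induction_on (p := fun x => J (J x) = x) x
      (isClosed_eq (by fun_prop) (by fun_prop)) fun y => ?_
  rw [hcomm, hJTJ]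

end Antiunitary

/-! ### Existence of bounded modular data -/

section ModularPair

variable {H : Type*} [NormedAddCommGroup H] [InnerProductSpace ℂ H]

/-- Bounded modular data of a standard subspace: `a = (1 + Δ)^{-1/2}`, `b = Δ^{1/2} (1 + Δ)^{-1/2}`
and the modular conjugation `J`. -/
structure BoundedModularData (V : StandardSubspace H) where
  /-- The operator `(1 + Δ)^{-1/2}`. -/
  a : H →L[ℂ] H
  /-- The operator `Δ^{1/2} (1 + Δ)^{-1/2}`. -/
  b : H →L[ℂ] H
  /-- The modular conjugation. -/
  J : H →L⋆[ℂ] H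
  a_nonneg : 0 ≤ a
  b_nonneg : 0 ≤ b
  comm : a * b = b * a
  sq_add_sq : a * a + b * b = 1
  a_injective : ∀ x, a x = 0 → x = 0
  b_injective : ∀ x, b x = 0 → x = 0
  norm_J : ∀ x, ‖J x‖ = ‖x‖
  J_J : ∀ x, J (J x) = x
  J_a : ∀ x, J (a x) = b (J x)
  mem_iff : ∀ x, x ∈ V.toClosedSubmodule ↔ a (J x) = b x

/-- The two conditions kill the real and the imaginary part of `⟪v, x⟫` for `v ∈ V`, so `x` is
orthogonal to the dense space `V + iV`. -/
theorem eq_zero_of_real_projection_eq_zero (V : StandardSubspace H) {P : H →L[ℝ] H}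
    (hP : ∀ x ∈ V.toClosedSubmodule, P x = x)
    (hs : ∀ x y, (inner ℂ (P x) y).re = (inner ℂ x (P y)).re) {x : H} (hx : P x = 0)
    (hx' : P (Complex.I • x) = 0) : x = 0 := by
  have h (z : H) (hz : P z = 0) (y : H) (hy : y ∈ V.toClosedSubmodule) :
      (inner ℂ y z).re = 0 := by
    rw [← hP y hy, hs, hz, inner_zero_right, Complex.zero_re]
  refine (dense_complexSpan V).eq_zero_of_inner_right ℂ fun z hz => ?_
  obtain ⟨u, hu, v, hv, rfl⟩ := hz
  have h1 := h x hx u hu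
  have h2 := h x hx v hv
  have h3 := h _ hx' u hu
  have h4 := h _ hx' v hv
  rw [inner_smul_right, Complex.mul_re, Complex.I_re, Complex.I_im] at h3 h4
  rw [inner_add_left, inner_smul_left, Complex.conj_I]
  refine Complex.ext ?_ ?_ <;> simp <;> linarith

theorem nonempty_boundedModularData [CompleteSpace H] (V : StandardSubspace H) :
    Nonempty (BoundedModularData V) := by
  obtain ⟨P, hPV, hPid, hPs⟩ := exists_real_projection V.toClosedSubmodule
  have hPP (x : H) : P (P x) = P x := hPid _ (hPV x)
  have hCs := inner_linearPart_symm hPs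
  have hDs := inner_antilinearPart_symm hPs
  have hparts := parts_of_idempotent hPP
  have hadd := linearPart_add_antilinearPart P
  set C := linearPart P
  set D := antilinearPart P
  have hDD (x : H) : D (D x) = C x - C (C x) := eq_sub_of_add_eq' (hparts x).1
  have hDC (x : H) : D (C x) = D x - C (D x) := eq_sub_of_add_eq' (hparts x).2
  -- This sum of squares, from `C = C² + D²`, gives both `C ≥ 0` and the implication from `C x = 0`
  -- to `D x = 0`. The next identity does the same for `1 - C`.
  have hC (x : H) : inner ℂ x (C x) = inner ℂ (C x) (C x) + inner ℂ (D x) (D x) := by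
    rw [hDs, hDD, inner_sub_right, hCs]; ring
  have hC' (x : H) : inner ℂ x ((1 - C) x) =
      inner ℂ ((1 - C) x) ((1 - C) x) + inner ℂ (D x) (D x) := by
    have : (1 - C) x = x - C x := rfl
    rw [hDs, hDD, this, inner_sub_left, inner_sub_right, inner_sub_right, inner_sub_right, hCs,
      hCs]
    ring
  have hC0 : 0 ≤ C := nonneg_of_inner hCs fun x => by
    rw [hC]; exact add_nonneg (inner_self_nonneg (𝕜 := ℂ)) (inner_self_nonneg (𝕜 := ℂ))
  have hC1 : 0 ≤ 1 - C := nonneg_of_inner (fun x y => by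
      change inner ℂ (x - C x) y = inner ℂ x (y - C y)
      rw [inner_sub_left, inner_sub_right, hCs]) fun x => by
    rw [hC']; exact add_nonneg (inner_self_nonneg (𝕜 := ℂ)) (inner_self_nonneg (𝕜 := ℂ))
  have hD0 (x z : H) (h : 0 = inner ℂ z z + inner ℂ (D x) (D x)) : D x = 0 := by
    have h1 : 0 ≤ (inner ℂ z z).re := inner_self_nonneg (𝕜 := ℂ)
    have h2 : 0 ≤ (inner ℂ (D x) (D x)).re := inner_self_nonneg (𝕜 := ℂ)
    have h3 := congrArg Complex.re h
    rw [Complex.zero_re, Complex.add_re] at h3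
    rw [← norm_eq_zero, ← sq_eq_zero_iff, ← inner_self_eq_norm_sq (𝕜 := ℂ), RCLike.re_to_complex]
    linarith
  have hCi (x : H) (hx : C x = 0) : x = 0 := by
    have h := hC x
    have hDx : D x = 0 := hD0 x (C x) (by rw [← h, hx, inner_zero_right])
    refine eq_zero_of_real_projection_eq_zero V hPid hPs ?_ ?_
    · rw [← hadd, hx, hDx, add_zero]
    · rw [← hadd, map_smul, map_smulₛₗ, hx, hDx, smul_zero, smul_zero, add_zero]
  -- Here `P` fixes both `x` and `i x`, so `x ∈ V ∩ iV = {0}`.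
  have hC1i (x : H) (hx : (1 - C) x = 0) : x = 0 := by
    have h := hC' x
    have hDx : D x = 0 := hD0 x ((1 - C) x) (by rw [← h, hx, inner_zero_right])
    have hCx : C x = x := (sub_eq_zero.mp hx).symm
    have h1 : P x = x := by rw [← hadd, hCx, hDx, add_zero]
    have h2 : P (Complex.I • x) = Complex.I • x := by
      rw [← hadd, map_smul, map_smulₛₗ, hCx, hDx, smul_zero, add_zero]
    exact eq_zero_of_mem_of_I_smul_mem V (h1 ▸ hPV x) (h2 ▸ hPV _)
  set a := CFC.sqrt C
  set b := CFC.sqrt (1 - C)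
  have ha0 : 0 ≤ a := CFC.sqrt_nonneg C
  have hb0 : 0 ≤ b := CFC.sqrt_nonneg (1 - C)
  have haa : a * a = C := CFC.sqrt_mul_sqrt_self C
  have hbb : b * b = 1 - C := CFC.sqrt_mul_sqrt_self (1 - C)
  have hab : Commute a b := by
    have h : Commute C (1 - C) := (Commute.one_right C).sub_right (Commute.refl C)
    exact ((h.cfcₙ_nnreal NNReal.sqrt).symm.cfcₙ_nnreal NNReal.sqrt).symm
  have hai (x : H) (hx : a x = 0) : x = 0 := hCi x (by
    rw [← haa, mul_apply_eq_comp, hx, map_zero])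
  have hbi (x : H) (hx : b x = 0) : x = 0 := hC1i x (by
    rw [← hbb, mul_apply_eq_comp, hx, map_zero])
  have hT0 : 0 ≤ a * b := hab.mul_nonneg ha0 hb0
  have hTi (x : H) (hx : (a * b) x = 0) : x = 0 := hbi x (hai _ hx)
  have hTd := denseRange_of_inner_symm_of_injective (inner_symm_of_nonneg hT0) hTi
  have hTT : (a * b) * (a * b) = C * (1 - C) := by
    rw [hab.symm.mul_mul_mul_comm, haa, hbb]
  obtain ⟨J, hJT, hJn, hJJ, hJTc⟩ := exists_antiunitary_polar hDs hT0 hTi (fun x => by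
    rw [hDD]
    have h := (DFunLike.congr_fun hTT x).symm
    rw [mul_sub, mul_one] at h
    exact h)
  -- On the range of `ab` this is the relation `DC = (1 - C) D`, since `J ab = D` and `C` commutes
  -- with `ab`.
  have hJC (x : H) : J (C x) = (1 - C) (J x) := by
    have hTC : Commute (a * b) C := by
      rw [← haa]
      exact ((Commute.refl a).mul_right (Commute.refl a)).mul_left
        (hab.symm.mul_right hab.symm)
    refine hTd.induction_on (p := fun x => J (C x) = (1 - C) (J x)) x
      (isClosed_eq (by fun_prop) (by fun_prop)) fun y => ?_
    have h : C ((a * b) y) = (a * b) (C y) := (DFunLike.congr_fun hTC y).symm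
    rw [h, hJT, hDC, hJT]
    rfl
  have hJa (x : H) : J (a x) = b (J x) := by
    -- `J a J` is a positive square root of `J C J = 1 - C`.
    have h : b = J.comp (a.comp J) := by
      refine CFC.sqrt_unique ?_ (antilinear_conj_nonneg (inner_map_map_of_antilinear hJn) hJJ ha0)
      ext x
      change J (a (J (J (a (J x))))) = (1 - C) x
      rw [hJJ, ← mul_apply_eq_comp, haa, hJC, hJJ]
    rw [h]
    change _ = J (a (J (J x)))
    rw [hJJ]
  have hJb (x : H) : J (b x) = a (J x) := by
    rw [← hJJ (a (J x)), hJa, hJJ]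
  refine ⟨⟨a, b, J, ha0, hb0, hab, by rw [haa, hbb]; abel, hai, hbi, hJn, hJJ, hJa, fun x => ?_⟩⟩
  have h1 : x ∈ V.toClosedSubmodule ↔ P x = x := ⟨hPid x, fun h => h ▸ hPV x⟩
  rw [h1, ← hadd, ← hJT, mul_apply_eq_comp, hJa, hJb]
  -- `P x = x` reads `C x + b a J x = x`; as `1 - C = b²`, one factor `b` can be cancelled by
  -- injectivity.
  have h2 : C x + b (a (J x)) = x ↔ b (a (J x)) = b (b x) := by
    have : b (b x) = x - C x := DFunLike.congr_fun hbb x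
    rw [this, eq_sub_iff_add_eq']
  rw [h2]
  refine ⟨fun h => ?_, fun h => by rw [h]⟩
  rw [← sub_eq_zero, ← map_sub] at h
  exact sub_eq_zero.mp (hbi _ h)

end ModularPair

end StandardModular

/-! ### Tomita operator, modular operator and conjugation in terms of `a`, `b`, `J` -/

namespace StandardModular

namespace BoundedModularData

variable {H : Type*} [NormedAddCommGroup H] [InnerProductSpace ℂ H] {V : StandardSubspace H}
  (d : BoundedModularData V)
include d

theorem J_b (x : H) : d.J (d.b x) = d.a (d.J x) := by
  rw [← d.J_J (d.a (d.J x)), d.J_a, d.J_J]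

theorem inner_J (x y : H) : inner ℂ (d.J x) (d.J y) = inner ℂ y x :=
  inner_map_map_of_antilinear d.norm_J x y

theorem inner_a (x y : H) : inner ℂ (d.a x) y = inner ℂ x (d.a y) :=
  inner_symm_of_nonneg d.a_nonneg x y

theorem inner_b (x y : H) : inner ℂ (d.b x) y = inner ℂ x (d.b y) :=
  inner_symm_of_nonneg d.b_nonneg x y

theorem a_b (x : H) : d.a (d.b x) = d.b (d.a x) := DFunLike.congr_fun d.comm x

theorem sq_apply (x : H) : d.a (d.a x) + d.b (d.b x) = x := DFunLike.congr_fun d.sq_add_sq x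

/-- Since `a² + b² = 1`, the map `y ↦ (a y, b y)` is isometric and its adjoint `(u, w) ↦ a u + b w`
recovers `y`; the equation `b u = a w` cuts out its range. All adjoints and compositions below
reduce to this. -/
theorem exists_of_b_eq_a {u w : H} (h : d.b u = d.a w) : ∃ y, u = d.a y ∧ w = d.b y := by
  refine ⟨d.a u + d.b w, ?_, ?_⟩
  · rw [map_add, d.a_b, ← h, d.sq_apply]
  · rw [map_add, ← d.a_b, h, d.sq_apply]

theorem a_inj {x y : H} (h : d.a x = d.a y) : x = y := by
  rw [← sub_eq_zero, ← map_sub] at h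
  exact sub_eq_zero.mp (d.a_injective _ h)

theorem a_mem {y : H} (hy : d.J y = y) : d.a y ∈ V.toClosedSubmodule := by
  rw [d.mem_iff, d.J_a, hy, d.a_b]

theorem exists_J_fixed (y : H) : ∃ y₁ y₂, d.J y₁ = y₁ ∧ d.J y₂ = y₂ ∧
    y = y₁ + Complex.I • y₂ := by
  refine ⟨(2⁻¹ : ℂ) • (y + d.J y), (2⁻¹ : ℂ) • (-Complex.I • (y - d.J y)), ?_, ?_, ?_⟩
  · rw [map_smulₛₗ, map_add, d.J_J, add_comm, map_inv₀, Complex.conj_ofNat]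
  · rw [map_smulₛₗ, map_smulₛₗ, map_sub, d.J_J, map_inv₀, Complex.conj_ofNat, map_neg,
      Complex.conj_I, neg_neg, neg_smul, ← smul_neg, neg_sub]
  · rw [smul_comm Complex.I, neg_smul, smul_neg, I_smul_I_smul, neg_neg, ← smul_add,
      show y + d.J y + (y - d.J y) = (2 : ℂ) • y by rw [two_smul]; abel, smul_smul]
    norm_num

/-- `V` consists of vectors `a y`, and conversely `a` maps `J`-fixed vectors into `V`. The real and
imaginary parts of `y` with respect to `J` give the decomposition in `V + iV`. -/
theorem mem_complexSpan_iff_exists {z : H} : z ∈ complexSpan V ↔ ∃ y, z = d.a y := by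
  constructor
  · have h (x : H) (hx : x ∈ V.toClosedSubmodule) : ∃ y, x = d.a y := by
      obtain ⟨y, hy, -⟩ := d.exists_of_b_eq_a ((d.mem_iff x).mp hx).symm
      exact ⟨y, hy⟩
    rintro ⟨x, hx, x', hx', rfl⟩
    obtain ⟨y, rfl⟩ := h x hx
    obtain ⟨y', rfl⟩ := h x' hx'
    exact ⟨y + Complex.I • y', by rw [map_add, map_smul]⟩
  · rintro ⟨y, rfl⟩
    obtain ⟨y₁, y₂, h1, h2, rfl⟩ := d.exists_J_fixed y
    exact ⟨_, d.a_mem h1, _, d.a_mem h2, by rw [map_add, map_smul]⟩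

theorem tomita_a (y : H) (h : d.a y ∈ (tomita V).domain) :
    tomita V ⟨d.a y, h⟩ = d.J (d.b y) := by
  obtain ⟨y₁, y₂, h1, h2, rfl⟩ := d.exists_J_fixed y
  have h3 : d.J (d.b (y₁ + Complex.I • y₂)) = d.a y₁ - Complex.I • d.a y₂ := by
    rw [d.J_b, map_add, map_smulₛₗ, h1, h2, Complex.conj_I, neg_smul, map_add, map_neg, map_smul,
      ← sub_eq_add_neg]
  rw [h3]
  exact tomitaFun_eq V (d.a_mem h1) (d.a_mem h2) _ (by simp)

/-- Written with `z = a q`, the defining relation of the adjoint is `⟪q, b J u⟫ = ⟪q, a w⟫`, that is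
`b (J u) = a w`. -/
theorem antiAdjoint_tomita_iff {u w : H} :
    (∀ z : (tomita V).domain, inner ℂ u (tomita V z) = inner ℂ (z : H) w) ↔
      ∃ y, d.J u = d.a y ∧ w = d.b y := by
  have h1 (q : H) : inner ℂ u (d.J (d.b q)) = inner ℂ q (d.b (d.J u)) := by
    conv_lhs => rw [← d.J_J u]
    rw [d.inner_J, d.inner_b]
  constructor
  · intro h
    refine d.exists_of_b_eq_a (ext_inner_left ℂ fun q => ?_)
    have hq : d.a q ∈ (tomita V).domain := d.mem_complexSpan_iff_exists.mpr ⟨q, rfl⟩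
    have h2 := h ⟨d.a q, hq⟩
    rw [d.tomita_a q hq, h1] at h2
    rw [h2, d.inner_a]
  · rintro ⟨y, hy, rfl⟩ ⟨z, hz⟩
    obtain ⟨q, rfl⟩ := d.mem_complexSpan_iff_exists.mp hz
    rw [d.tomita_a, h1, hy, d.inner_a, d.a_b]

theorem mem_graph_modularOperator {x w : H} :
    (x, w) ∈ (modularOperator V).graph ↔ ∃ y, x = d.a (d.a y) ∧ w = d.b (d.b y) := by
  have hadj {u w : H} (h : u ∈ (antiAdjoint (tomita V) (dense_complexSpan V)).domain)
      (hw : antiAdjoint (tomita V) (dense_complexSpan V) ⟨u, h⟩ = w) :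
      ∃ y, d.J u = d.a y ∧ w = d.b y :=
    d.antiAdjoint_tomita_iff.mp fun z => by
      rw [← hw]; exact inner_antiAdjoint ⟨u, h⟩ z
  rw [LinearPMap.mem_graph_iff]
  constructor
  · rintro ⟨⟨_, hx, hx'⟩, rfl, hw⟩
    obtain ⟨q, rfl⟩ := d.mem_complexSpan_iff_exists.mp hx
    obtain ⟨y, hy, rfl⟩ := hadj hx' hw
    rw [d.tomita_a, d.J_J] at hy
    obtain ⟨y', rfl, rfl⟩ := d.exists_of_b_eq_a hy
    exact ⟨y', rfl, rfl⟩
  · rintro ⟨y, rfl, rfl⟩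
    have h1 : d.a (d.a y) ∈ (tomita V).domain := d.mem_complexSpan_iff_exists.mpr ⟨_, rfl⟩
    have h2 : tomita V ⟨_, h1⟩ ∈ (antiAdjoint (tomita V) (dense_complexSpan V)).domain :=
      ⟨d.b (d.b y), d.antiAdjoint_tomita_iff.mpr
        ⟨d.b y, by rw [d.tomita_a, d.J_J, d.a_b], rfl⟩⟩
    refine ⟨⟨_, h1, h2⟩, rfl, ?_⟩
    obtain ⟨y', h3, h4⟩ := hadj h2 rfl
    rw [d.tomita_a, d.J_J, ← d.a_b] at h3
    exact (antiComp_apply h1 h2).trans (by rw [h4, d.a_inj h3])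

/-- The operator `Δ^{1/2}`, with graph `{(a y, b y)}`. -/
noncomputable def sqrtModular : H →ₗ.[ℂ] H where
  domain := LinearMap.range d.a.toLinearMap
  toFun := d.b.toLinearMap ∘ₗ (LinearEquiv.ofInjective d.a.toLinearMap fun _ _ => d.a_inj).symm

theorem sqrtModular_apply {y : H} (h : d.a y ∈ d.sqrtModular.domain) :
    d.sqrtModular ⟨d.a y, h⟩ = d.b y := by
  change d.b ((LinearEquiv.ofInjective d.a.toLinearMap fun _ _ => d.a_inj).symm ⟨d.a y, h⟩) = _
  congr 1
  rw [LinearEquiv.symm_apply_eq]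
  rfl

theorem mem_graph_sqrtModular {x w : H} :
    (x, w) ∈ d.sqrtModular.graph ↔ ∃ y, x = d.a y ∧ w = d.b y := by
  rw [LinearPMap.mem_graph_iff]
  constructor
  · rintro ⟨⟨_, y, rfl⟩, rfl, rfl⟩
    exact ⟨y, rfl, d.sqrtModular_apply _⟩
  · rintro ⟨y, rfl, rfl⟩
    exact ⟨⟨d.a y, y, rfl⟩, rfl, d.sqrtModular_apply _⟩

theorem isSelfAdjoint_sqrtModular [CompleteSpace H] : IsSelfAdjoint d.sqrtModular := by
  have hd : Dense (d.sqrtModular.domain : Set H) :=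
    denseRange_of_inner_symm_of_injective d.inner_a d.a_injective
  have hle : d.sqrtModular ≤ d.sqrtModular.adjoint := by
    refine LinearPMap.IsFormalAdjoint.le_adjoint hd ?_
    rintro ⟨_, x, rfl⟩ ⟨_, y, rfl⟩
    simp only [ContinuousLinearMap.coe_coe]
    rw [d.sqrtModular_apply, d.sqrtModular_apply, d.inner_b, d.inner_a, d.a_b]
  refine (LinearPMap.isSelfAdjoint_def).mpr (LinearPMap.eq_of_le_of_domain_eq hle
    (le_antisymm hle.1 fun u hu => ?_)).symm
  have hf := LinearPMap.adjoint_isFormalAdjoint hd ⟨u, hu⟩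
  -- Testing the adjoint relation on `a q` says `b u = a w`, so `u` already lies in the range of
  -- `a`.
  obtain ⟨y, hy, -⟩ := d.exists_of_b_eq_a (u := u) (w := d.sqrtModular.adjoint ⟨u, hu⟩)
    (ext_inner_right ℂ fun q => by
      have hq : d.a q ∈ d.sqrtModular.domain := ⟨q, rfl⟩
      have h := hf ⟨d.a q, hq⟩
      rw [d.sqrtModular_apply hq] at h
      rw [d.inner_b, d.inner_a, ← h])
  exact ⟨y, hy.symm⟩

theorem isPositiveSqrt_sqrtModular [CompleteSpace H] :
    IsPositiveSqrt d.sqrtModular (modularOperator V) := by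
  refine ⟨d.isSelfAdjoint_sqrtModular, ?_, fun x w => ?_⟩
  · rintro ⟨_, y, rfl⟩
    simp only [ContinuousLinearMap.coe_coe]
    rw [d.sqrtModular_apply, d.inner_a]
    exact re_inner_nonneg_of_nonneg
      (Commute.mul_nonneg d.a_nonneg d.b_nonneg d.comm) y
  · simp only [d.mem_graph_modularOperator, d.mem_graph_sqrtModular]
    constructor
    · rintro ⟨y, rfl, rfl⟩
      exact ⟨d.b (d.a y), ⟨_, rfl, rfl⟩, _, (d.a_b y).symm, rfl⟩
    · rintro ⟨_, ⟨y, rfl, rfl⟩, y', h, rfl⟩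
      obtain ⟨q, rfl, rfl⟩ := d.exists_of_b_eq_a h
      exact ⟨q, rfl, rfl⟩

theorem isModularConjugation_J [CompleteSpace H] : IsModularConjugation V d.J := by
  refine ⟨AddMonoidHomClass.isometry_of_norm d.J d.norm_J, fun x => ⟨d.J x, d.J_J x⟩,
    d.sqrtModular, d.isPositiveSqrt_sqrtModular, fun x => ?_, ?_⟩
  · rw [tomita_domain, d.mem_complexSpan_iff_exists]
    exact ⟨fun ⟨y, hy⟩ => ⟨y, hy.symm⟩, fun ⟨y, hy⟩ => ⟨y, hy.symm⟩⟩
  · rintro _ ⟨y, rfl⟩ h'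
    simp only [ContinuousLinearMap.coe_coe]
    rw [d.sqrtModular_apply]
    exact d.tomita_a y h'

/-- Uniqueness of the positive square root of `Δ_V`, transferred to bounded operators: `S a²` is
everywhere defined, bounded and positive with square `(ab)²`, so it equals `ab`. -/
theorem eq_sqrt_of_isPositiveSqrt [CompleteSpace H] {S : H →ₗ.[ℂ] H}
    (hS : IsPositiveSqrt S (modularOperator V)) (x : H) :
    (d.a (d.a x), d.a (d.b x)) ∈ S.graph := by
  obtain ⟨hsa, hpos, hsq⟩ := hS
  have hsym : S.IsFormalAdjoint S := by
    have h := LinearPMap.adjoint_isFormalAdjoint hsa.dense_domain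
    rwa [LinearPMap.isSelfAdjoint_def.mp hsa] at h
  have hsymm {x y x' y' : H} (h : (x, y) ∈ S.graph) (h' : (x', y') ∈ S.graph) :
      inner ℂ y x' = inner ℂ x y' := by
    rw [LinearPMap.mem_graph_iff] at h h'
    obtain ⟨u, rfl, rfl⟩ := h
    obtain ⟨u', rfl, rfl⟩ := h'
    exact hsym u u'
  have hpos' {x y : H} (h : (x, y) ∈ S.graph) : 0 ≤ (inner ℂ x y).re := by
    rw [LinearPMap.mem_graph_iff] at h
    obtain ⟨u, rfl, rfl⟩ := h
    exact hpos u
  have hex (y : H) : ∃ z, (d.a (d.a y), z) ∈ S.graph ∧ (z, d.b (d.b y)) ∈ S.graph :=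
    (hsq _ _).mp (d.mem_graph_modularOperator.mpr ⟨y, rfl, rfl⟩)
  choose B hB1 hB2 using hex
  have huniq {x y y' : H} (h : (x, y) ∈ S.graph) (h' : (x, y') ∈ S.graph) : y = y' :=
    S.mem_graph_snd_inj h h' rfl
  have hBadd (x y : H) : B (x + y) = B x + B y := by
    refine huniq (hB1 (x + y)) ?_
    have := S.graph.add_mem (hB1 x) (hB1 y)
    simpa using this
  have hBsmul (c : ℂ) (x : H) : B (c • x) = c • B x := by
    refine huniq (hB1 (c • x)) ?_
    have := S.graph.smul_mem c (hB1 x)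
    simpa using this
  have hBin (x y : H) : inner ℂ (B x) (B y) = inner ℂ (d.a (d.a x)) (d.b (d.b y)) :=
    hsymm (hB1 x) (hB2 y)
  have hBx (x : H) : inner ℂ (B x) (B x) = inner ℂ (d.b (d.a x)) (d.b (d.a x)) := by
    rw [hBin, ← d.inner_b, ← d.a_b, d.inner_a, d.a_b]
  let L : H →ₗ[ℂ] H := { toFun := B, map_add' := hBadd, map_smul' := hBsmul }
  have hLn (x : H) : ‖L x‖ ≤ ‖d.b * d.a‖ * ‖x‖ := by
    have h := hBx x
    rw [inner_self_eq_norm_sq_to_K, inner_self_eq_norm_sq_to_K] at h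
    have h2 : ‖B x‖ = ‖(d.b * d.a) x‖ :=
      (sq_eq_sq₀ (norm_nonneg _) (norm_nonneg _)).mp (by exact_mod_cast h)
    exact h2.trans_le ((d.b * d.a).le_opNorm x)
  obtain ⟨B', hB'⟩ : ∃ B' : H →L[ℂ] H, ∀ x, B' x = B x := ⟨L.mkContinuous _ hLn, fun _ => rfl⟩
  -- Splitting the other vector as `a² + b²` leaves pairings between points of the graph of `S`,
  -- where symmetry of `S` applies.
  have hB's (x y : H) : inner ℂ (B' x) y = inner ℂ x (B' y) := by
    rw [hB', hB']
    conv_lhs => rw [← d.sq_apply y]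
    conv_rhs => rw [← d.sq_apply x]
    rw [inner_add_left, inner_add_right, hsymm (hB1 x) (hB1 y), hsymm (hB2 x) (hB2 y)]
  have hB'0 : 0 ≤ B' := nonneg_of_inner hB's fun x => by
    rw [hB']
    conv => enter [2, 1, 2]; rw [← d.sq_apply x]
    rw [inner_add_left, Complex.add_re, hsymm (hB2 x) (hB2 x)]
    exact add_nonneg (hpos' (hB1 x)) (hpos' (hB2 x))
  have hBT : B' = d.a * d.b := by
    refine (CFC.mul_self_eq_mul_self_iff _ _ hB'0
      (Commute.mul_nonneg d.a_nonneg d.b_nonneg d.comm)).mp ?_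
    ext x
    refine ext_inner_left ℂ fun y => ?_
    change inner ℂ y (B' (B' x)) = inner ℂ y (d.a (d.b (d.a (d.b x))))
    rw [← hB's, hB', hB', hBin, d.inner_a, d.inner_a, d.a_b (d.b x)]
  have h := hB1 x
  rwa [← hB', hBT] at h

/-- At `a² x` the polar decomposition reads `J (a b x) = d.J (b a x)`, and `ab` has dense range. -/
theorem eq_J_of_isModularConjugation [CompleteSpace H] {J : H →L⋆[ℂ] H}
    (hJ : IsModularConjugation V J) : J = d.J := by
  obtain ⟨-, -, S, hS, hdom, hpol⟩ := hJ
  have hTd := denseRange_of_inner_symm_of_injective (A := d.a * d.b)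
    (inner_symm_of_nonneg (Commute.mul_nonneg d.a_nonneg d.b_nonneg d.comm))
    fun x hx => d.b_injective x (d.a_injective _ hx)
  refine DFunLike.coe_injective (hTd.equalizer J.continuous d.J.continuous (funext fun x => ?_))
  have h := S.mem_graph_iff.mp (d.eq_sqrt_of_isPositiveSqrt hS x)
  obtain ⟨⟨_, hx⟩, rfl, h2⟩ := h
  have hx' := (hdom _).mp hx
  have h3 := hpol _ hx hx'
  rw [d.tomita_a _ hx', h2] at h3
  change J (d.a (d.b x)) = d.J (d.a (d.b x))
  rw [← h3, d.a_b]

theorem modularConjugation_eq [CompleteSpace H] : modularConjugation V = d.J := by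
  have h : ∃ J, IsModularConjugation V J := ⟨d.J, d.isModularConjugation_J⟩
  rw [modularConjugation, dif_pos h]
  exact d.eq_J_of_isModularConjugation h.choose_spec

end BoundedModularData

end StandardModular

/-! ### Commutation relations expressed through `a²` -/

namespace StandardModular

namespace BoundedModularData

variable {H : Type*} [NormedAddCommGroup H] [InnerProductSpace ℂ H] [CompleteSpace H]
  {V : StandardSubspace H} (d : BoundedModularData V) {A : H →L[ℂ] H}
include d

theorem commute_a (h : Commute A (d.a * d.a)) : Commute A d.a := by
  have h1 : CFC.sqrt (d.a * d.a) = d.a := CFC.sqrt_mul_self d.a d.a_nonneg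
  rw [← h1]
  exact (h.symm.cfcₙ_nnreal NNReal.sqrt).symm

omit [CompleteSpace H] in
theorem b_mul_b : d.b * d.b = 1 - d.a * d.a := by
  rw [← d.sq_add_sq, add_sub_cancel_left]

theorem commute_b (h : Commute A (d.a * d.a)) : Commute A d.b := by
  have h1 : CFC.sqrt (d.b * d.b) = d.b := CFC.sqrt_mul_self d.b d.b_nonneg
  have h2 : Commute A (d.b * d.b) := by
    rw [d.b_mul_b]; exact (Commute.one_right A).sub_right h
  rw [← h1]
  exact (h2.symm.cfcₙ_nnreal NNReal.sqrt).symm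

theorem preserves_of_commute (h : Commute A (d.a * d.a)) (hJ : ∀ x, A (d.J x) = d.J (A x)) :
    Preserves A V := by
  have ha (x : H) : A (d.a x) = d.a (A x) := DFunLike.congr_fun (d.commute_a h) x
  have hb (x : H) : A (d.b x) = d.b (A x) := DFunLike.congr_fun (d.commute_b h) x
  intro x hx
  rw [d.mem_iff] at hx ⊢
  rw [← hJ, ← ha, hx, hb]

omit [CompleteSpace H] d in
theorem antilinear_eq_zero_of_vanish {B : H →L⋆[ℂ] H} (hB : ∀ x ∈ V.toClosedSubmodule, B x = 0)
    (x : H) : B x = 0 := by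
  refine (dense_complexSpan V).induction (P := fun x => B x = 0) ?_
    (isClosed_eq (by fun_prop) (by fun_prop)) x
  rintro _ ⟨u, hu, v, hv, rfl⟩
  rw [map_add, map_smulₛₗ, hB u hu, hB v hv, smul_zero, add_zero]

theorem J_comm_of_preserves (h : Commute A (d.a * d.a)) (hV : Preserves A V) (x : H) :
    A (d.J x) = d.J (A x) := by
  have ha (x : H) : A (d.a x) = d.a (A x) := DFunLike.congr_fun (d.commute_a h) x
  have hb (x : H) : A (d.b x) = d.b (A x) := DFunLike.congr_fun (d.commute_b h) x
  -- For `x ∈ V` the equations of `V` at `x` and at `A x` give `a (A J x) = b (A x) = a (J A x)`;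
  -- `a` is injective.
  have h1 := antilinear_eq_zero_of_vanish (V := V) (B := A.comp d.J - d.J.comp A) (fun x hx => ?_) x
  · exact sub_eq_zero.mp h1
  · change A (d.J x) - d.J (A x) = 0
    have h2 := (d.mem_iff _).mp (hV x hx)
    rw [d.mem_iff] at hx
    rw [← hb, ← hx, ha] at h2
    rw [d.a_inj h2, sub_self]

omit [CompleteSpace H] in
theorem commute_of_preserves (hV : Preserves A V) (hJ : ∀ x, A (d.J x) = d.J (A x)) :
    Commute A (d.a * d.a) := by
  -- This is the equation of `V` at `A a y`, because `J A a y = A b y` when `J y = y`.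
  have h1 (y : H) (hy : d.J y = y) : d.a (A (d.b y)) = d.b (A (d.a y)) := by
    have h := (d.mem_iff _).mp (hV _ (d.a_mem hy))
    rwa [← hJ, d.J_a, hy] at h
  have h2 (y : H) : d.a (A (d.b y)) = d.b (A (d.a y)) := by
    obtain ⟨y₁, y₂, hy₁, hy₂, rfl⟩ := d.exists_J_fixed y
    simp only [map_add, map_smul, h1 y₁ hy₁, h1 y₂ hy₂]
  have h3 : d.a * A * d.b = d.b * A * d.a := by
    ext y; exact h2 y
  have h4 : (d.a * d.a) * A * (d.b * d.b) = (d.b * d.b) * A * (d.a * d.a) := by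
    calc (d.a * d.a) * A * (d.b * d.b) = d.a * (d.a * A * d.b) * d.b := by simp only [mul_assoc]
      _ = (d.a * d.b) * A * (d.b * d.a) := by
        rw [h3]; simp only [mul_assoc]; rw [d.comm]
      _ = d.b * (d.a * A * d.b) * d.a := by rw [d.comm]; simp only [mul_assoc]
      _ = _ := by rw [h3]; simp only [mul_assoc]
  rw [d.b_mul_b, mul_sub, mul_one, sub_mul, sub_mul, one_mul] at h4
  exact (sub_left_injective h4).symm

/-- The graph is `{(a² y, b² y)}` and the coordinates of a point add up to its parameter `y`. Hence
a `g` preserving the graph acts on parameters by `y ↦ g y`. -/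
theorem unitaryConj_modularOperator_eq_iff (g : unitary (H →L[ℂ] H)) :
    unitaryConj g (modularOperator V) = modularOperator V ↔
      Commute (g : H →L[ℂ] H) (d.a * d.a) := by
  have hg (x : H) : (g : H →L[ℂ] H) (((g⁻¹ : unitary (H →L[ℂ] H)) : H →L[ℂ] H) x) = x := by
    rw [← mul_apply_eq_comp, ← Submonoid.coe_mul, mul_inv_cancel]; rfl
  have hg' (x : H) : ((g⁻¹ : unitary (H →L[ℂ] H)) : H →L[ℂ] H) ((g : H →L[ℂ] H) x) = x := by
    rw [← mul_apply_eq_comp, ← Submonoid.coe_mul, inv_mul_cancel]; rfl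
  have hgraph {x w : H} : ((g : H →L[ℂ] H) x, (g : H →L[ℂ] H) w) ∈
      (unitaryConj g (modularOperator V)).graph ↔ (x, w) ∈ (modularOperator V).graph := by
    rw [LinearPMap.mem_graph_iff, LinearPMap.mem_graph_iff]
    constructor
    · rintro ⟨⟨z, hz⟩, h1, h2⟩
      refine ⟨⟨_, hz⟩, ?_, ?_⟩
      · change z = (g : H →L[ℂ] H) x at h1
        subst h1
        exact hg' x
      · have h3 := congrArg ((g⁻¹ : unitary (H →L[ℂ] H)) : H →L[ℂ] H) h2
        exact ((hg' _).symm.trans h3).trans (hg' w)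
    · rintro ⟨⟨z, hz⟩, rfl, rfl⟩
      refine ⟨⟨(g : H →L[ℂ] H) z, ?_⟩, rfl, ?_⟩
      · change ((g⁻¹ : unitary (H →L[ℂ] H)) : H →L[ℂ] H) ((g : H →L[ℂ] H) z) ∈
          (modularOperator V).domain
        rw [hg']; exact hz
      · change (g : H →L[ℂ] H) (modularOperator V
          ⟨((g⁻¹ : unitary (H →L[ℂ] H)) : H →L[ℂ] H) ((g : H →L[ℂ] H) z), _⟩) = _
        congr 2
        exact Subtype.ext (hg' z)
  constructor
  · intro h
    rw [h] at hgraph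
    ext y
    obtain ⟨z, hz, hz'⟩ := d.mem_graph_modularOperator.mp
      (hgraph.mpr (d.mem_graph_modularOperator.mpr ⟨y, rfl, rfl⟩))
    have h1 : (g : H →L[ℂ] H) y = z := by
      conv_lhs => rw [← d.sq_apply y]
      rw [map_add, hz, hz', d.sq_apply]
    change (g : H →L[ℂ] H) (d.a (d.a y)) = d.a (d.a ((g : H →L[ℂ] H) y))
    rw [h1, hz]
  · intro h
    have ha (x : H) : (g : H →L[ℂ] H) (d.a x) = d.a ((g : H →L[ℂ] H) x) :=
      DFunLike.congr_fun (d.commute_a h) x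
    have hb (x : H) : (g : H →L[ℂ] H) (d.b x) = d.b ((g : H →L[ℂ] H) x) :=
      DFunLike.congr_fun (d.commute_b h) x
    refine LinearPMap.eq_of_eq_graph (SetLike.ext fun p => ?_)
    obtain ⟨x, w⟩ := p
    rw [← hg x, ← hg w, hgraph, d.mem_graph_modularOperator, d.mem_graph_modularOperator]
    constructor
    · rintro ⟨y, h1, h2⟩
      refine ⟨(g : H →L[ℂ] H) y, ?_, ?_⟩
      · rw [h1, ha, ha]
      · rw [h2, hb, hb]
    · rintro ⟨y, h1, h2⟩
      refine ⟨((g⁻¹ : unitary (H →L[ℂ] H)) : H →L[ℂ] H) y, ?_, ?_⟩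
      · rw [← hg y, ← ha, ← ha] at h1
        rw [← hg' (((g⁻¹ : unitary (H →L[ℂ] H)) : H →L[ℂ] H) x), h1, hg']
      · rw [← hg y, ← hb, ← hb] at h2
        rw [← hg' (((g⁻¹ : unitary (H →L[ℂ] H)) : H →L[ℂ] H) w), h2, hg']

end BoundedModularData

end StandardModular

/-! ### Polarization and weak operator integrals -/

namespace StandardModular

section Polarization

open Filter Topology

variable {H : Type*} [NormedAddCommGroup H] [InnerProductSpace ℂ H]

/-- The polarization of a quadratic form. -/
noncomputable def polarization (q : H → ℂ) (x y : H) : ℂ :=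
  (q (x + y) - q (x - y) - Complex.I * q (x + Complex.I • y) +
    Complex.I * q (x - Complex.I • y)) / 4

theorem inner_eq_polarization (U : H →L[ℂ] H) (x y : H) :
    inner ℂ x (U y) = polarization (fun z => inner ℂ z (U z)) x y := by
  simp only [polarization, map_add, map_sub, inner_add_left, inner_add_right, map_smul,
    inner_smul_left, inner_smul_right, Complex.conj_I, inner_sub_left, inner_sub_right]
  linear_combination (inner ℂ x (U y) - inner ℂ y (U x)) / 2 * Complex.I_sq

theorem tendsto_polarization {ι : Type*} {l : Filter ι} {p : ι → H → ℂ} {q : H → ℂ}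
    (h : ∀ x, Tendsto (fun n => p n x) l (𝓝 (q x))) (x y : H) :
    Tendsto (fun n => polarization (p n) x y) l (𝓝 (polarization q x y)) :=
  ((((h _).sub (h _)).sub ((h _).const_mul _)).add ((h _).const_mul _)).div_const _

theorem tendsto_inner_of_tendsto_quadratic {ι : Type*} {l : Filter ι} {U : ι → H →L[ℂ] H}
    {W : H →L[ℂ] H} (h : ∀ x, Tendsto (fun n => inner ℂ x (U n x)) l (𝓝 (inner ℂ x (W x))))
    (x y : H) : Tendsto (fun n => inner ℂ x (U n y)) l (𝓝 (inner ℂ x (W y))) := by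
  rw [inner_eq_polarization]
  exact (tendsto_polarization h x y).congr fun n => (inner_eq_polarization _ _ _).symm

theorem eq_of_quadratic_eq {U W : H →L[ℂ] H} (h : ∀ x, inner ℂ x (U x) = inner ℂ x (W x)) :
    U = W := by
  ext y
  refine ext_inner_left ℂ fun x => ?_
  rw [inner_eq_polarization, inner_eq_polarization]
  simp only [h]

theorem norm_polarization_le {q : H → ℂ} {M : ℝ} (hM : 0 ≤ M)
    (hq : ∀ x, ‖q x‖ ≤ M * ‖x‖ ^ 2) {x y : H} (hx : ‖x‖ ≤ 1) (hy : ‖y‖ ≤ 1) :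
    ‖polarization q x y‖ ≤ 4 * M := by
  have h (z : H) (hz : ‖z‖ ≤ 2) : ‖q z‖ ≤ 4 * M := by
    refine (hq z).trans ?_
    have : ‖z‖ ^ 2 ≤ 2 ^ 2 := by gcongr
    nlinarith
  have hI : ‖Complex.I • y‖ ≤ 1 := by rw [norm_smul, Complex.norm_I, one_mul]; exact hy
  have h1 := h (x + y) ((norm_add_le _ _).trans (by linarith))
  have h2 := h (x - y) ((norm_sub_le _ _).trans (by linarith))
  have h3 := h (x + Complex.I • y) ((norm_add_le _ _).trans (by linarith))
  have h4 := h (x - Complex.I • y) ((norm_sub_le _ _).trans (by linarith))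
  rw [polarization, norm_div]
  have h5 : ‖(4 : ℂ)‖ = 4 := by norm_num
  rw [h5, div_le_iff₀ (by norm_num)]
  refine (norm_add_le _ _).trans ?_
  refine (add_le_add_left ((norm_sub_le _ _).trans (add_le_add_left (norm_sub_le _ _) _)) _).trans ?_
  rw [norm_mul, norm_mul, Complex.norm_I]
  linarith

/-- Sesquilinearity of the polarized limit form is inherited from the approximating operators, and
the bound makes it continuous, so it is represented by an operator. -/
theorem exists_operator_of_tendsto_quadratic [CompleteSpace H] {ι : Type*} {l : Filter ι}
    [l.NeBot] {U : ι → H →L[ℂ] H} {q : H → ℂ} {M : ℝ}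
    (h : ∀ x, Tendsto (fun n => inner ℂ x (U n x)) l (𝓝 (q x)))
    (hq : ∀ x, ‖q x‖ ≤ M * ‖x‖ ^ 2) : ∃ W : H →L[ℂ] H, ∀ x, inner ℂ x (W x) = q x := by
  wlog hM : 0 ≤ M generalizing M
  · exact this (M := |M|) (fun x => (hq x).trans (by gcongr; exact le_abs_self M)) (abs_nonneg M)
  have hB (x y : H) : Tendsto (fun n => inner ℂ x (U n y)) l (𝓝 (polarization q x y)) :=
    (tendsto_polarization h x y).congr fun n => (inner_eq_polarization _ _ _).symm
  have add_l (x x' y : H) : polarization q (x + x') y = polarization q x y + polarization q x' y :=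
    tendsto_nhds_unique (hB _ _) (by
      simpa only [inner_add_left] using (hB x y).add (hB x' y))
  have add_r (x y y' : H) : polarization q x (y + y') = polarization q x y + polarization q x y' :=
    tendsto_nhds_unique (hB _ _) (by
      simpa only [inner_add_right, map_add] using (hB x y).add (hB x y'))
  have smul_l (c : ℂ) (x y : H) :
      polarization q (c • x) y = starRingEnd ℂ c * polarization q x y :=
    tendsto_nhds_unique (hB _ _) (by
      simpa only [inner_smul_left] using (hB x y).const_mul _)
  have smul_r (c : ℂ) (x y : H) : polarization q x (c • y) = c * polarization q x y :=
    tendsto_nhds_unique (hB _ _) (by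
      simpa only [inner_smul_right, map_smul] using (hB x y).const_mul _)
  -- The representation has the form `B y x = ⟪W y, x⟫`, with the operator on the left; hence the
  -- swap and the conjugate.
  let B : H →ₗ⋆[ℂ] H →ₗ[ℂ] ℂ := LinearMap.mk₂'ₛₗ (starRingEnd ℂ) (RingHom.id ℂ)
    (fun y x => starRingEnd ℂ (polarization q x y))
    (fun y y' x => by rw [add_r, map_add]) (fun c y x => by simp [smul_r])
    (fun y x x' => by rw [add_l, map_add]) (fun c y x => by simp [smul_l])
  have hBn (y x : H) : ‖B y x‖ ≤ 4 * M * ‖y‖ * ‖x‖ := by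
    change ‖starRingEnd ℂ (polarization q x y)‖ ≤ _
    rw [RCLike.norm_conj]
    have hx : x = ((‖x‖ : ℝ) : ℂ) • ((‖x‖⁻¹ : ℝ) : ℂ) • x := by
      rcases eq_or_ne x 0 with rfl | hx
      · simp
      · rw [smul_smul, ← Complex.ofReal_mul, mul_inv_cancel₀ (norm_ne_zero_iff.mpr hx)]; simp
    have hy : y = ((‖y‖ : ℝ) : ℂ) • ((‖y‖⁻¹ : ℝ) : ℂ) • y := by
      rcases eq_or_ne y 0 with rfl | hx
      · simp
      · rw [smul_smul, ← Complex.ofReal_mul, mul_inv_cancel₀ (norm_ne_zero_iff.mpr hx)]; simp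
    have hn (z : H) : ‖((‖z‖⁻¹ : ℝ) : ℂ) • z‖ ≤ 1 := by
      rw [norm_smul, Complex.norm_real, norm_inv, norm_norm]
      exact inv_mul_le_one
    conv_lhs => rw [hx, hy, smul_l, smul_r, norm_mul, norm_mul, RCLike.norm_conj,
      Complex.norm_real, Complex.norm_real, norm_norm, norm_norm]
    have := norm_polarization_le hM hq (hn x) (hn y)
    calc _ ≤ ‖x‖ * (‖y‖ * (4 * M)) := by gcongr
      _ = _ := by ring
  refine ⟨InnerProductSpace.continuousLinearMapOfBilin (B.mkContinuous₂ (4 * M) hBn), fun x => ?_⟩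
  have h1 : inner ℂ x (InnerProductSpace.continuousLinearMapOfBilin
      (B.mkContinuous₂ (4 * M) hBn) x) = polarization q x x := by
    rw [← inner_conj_symm, InnerProductSpace.continuousLinearMapOfBilin_apply]
    exact Complex.conj_conj _
  rw [h1]
  exact tendsto_nhds_unique (hB x x) (h x)

end Polarization

section OperatorIntegral

open Filter Topology MeasureTheory

variable {H : Type*} [NormedAddCommGroup H] [InnerProductSpace ℂ H]
  {X : Type*} [MeasurableSpace X]

/-- The bounded operator `U` is the integral of `f` against the family of measures `μ`, which
is thought of as a quadratic form with values in measures. -/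
def IsOperatorIntegral (μ : H → Measure X) (f : X → ℂ) (U : H →L[ℂ] H) : Prop :=
  ∀ x, inner ℂ x (U x) = ∫ r, f r ∂(μ x)

variable {μ : H → Measure X}

namespace IsOperatorIntegral

theorem unique {f : X → ℂ} {U W : H →L[ℂ] H} (hU : IsOperatorIntegral μ f U)
    (hW : IsOperatorIntegral μ f W) : U = W :=
  eq_of_quadratic_eq fun x => by rw [hU, hW]

theorem add {f g : X → ℂ} {U W : H →L[ℂ] H} (hU : IsOperatorIntegral μ f U)
    (hW : IsOperatorIntegral μ g W) (hf : ∀ x, Integrable f (μ x))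
    (hg : ∀ x, Integrable g (μ x)) : IsOperatorIntegral μ (f + g) (U + W) := fun x => by
  change inner ℂ x (U x + W x) = ∫ r, (f r + g r) ∂(μ x)
  rw [inner_add_right, integral_add (hf x) (hg x), hU, hW]

theorem sub {f g : X → ℂ} {U W : H →L[ℂ] H} (hU : IsOperatorIntegral μ f U)
    (hW : IsOperatorIntegral μ g W) (hf : ∀ x, Integrable f (μ x))
    (hg : ∀ x, Integrable g (μ x)) : IsOperatorIntegral μ (f - g) (U - W) := fun x => by
  change inner ℂ x (U x - W x) = ∫ r, (f r - g r) ∂(μ x)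
  rw [inner_sub_right, integral_sub (hf x) (hg x), hU, hW]

theorem smul {f : X → ℂ} {U : H →L[ℂ] H} (c : ℂ) (hU : IsOperatorIntegral μ f U) :
    IsOperatorIntegral μ (fun r => c * f r) (c • U) := fun x => by
  change inner ℂ x (c • U x) = _
  rw [inner_smul_right, integral_const_mul, hU]

theorem conj [CompleteSpace H] {f : X → ℂ} {U : H →L[ℂ] H} (hU : IsOperatorIntegral μ f U) :
    IsOperatorIntegral μ (fun r => starRingEnd ℂ (f r)) (star U) := fun x => by
  rw [integral_conj, ← hU, inner_conj_symm, ContinuousLinearMap.star_eq_adjoint,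
    ContinuousLinearMap.adjoint_inner_right]

end IsOperatorIntegral

theorem exists_isOperatorIntegral_of_tendsto [CompleteSpace H]
    (hμ : ∀ x, μ x Set.univ ≤ ENNReal.ofReal (‖x‖ ^ 2)) {f : X → ℂ} {g : ℕ → X → ℂ} {c : ℝ}
    (h0 : 0 ≤ c) (hg : ∀ n, Measurable (g n)) (hc : ∀ n r, ‖g n r‖ ≤ c)
    (hlim : ∀ r, Tendsto (fun n => g n r) atTop (𝓝 (f r))) {U : ℕ → H →L[ℂ] H}
    (hU : ∀ n, IsOperatorIntegral μ (g n) (U n)) : ∃ W, IsOperatorIntegral μ f W := by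
  have hfin (x : H) : IsFiniteMeasure (μ x) := ⟨(hμ x).trans_lt ENNReal.ofReal_lt_top⟩
  refine exists_operator_of_tendsto_quadratic (l := atTop) (U := U) (M := c) (fun x => ?_)
    fun x => ?_
  · simp only [hU _ x]
    exact tendsto_integral_of_dominated_convergence (fun _ => c)
      (fun n => (hg n).aestronglyMeasurable) (integrable_const c)
      (fun n => Eventually.of_forall (hc n)) (Eventually.of_forall hlim)
  · refine (norm_integral_le_of_norm_le_const (C := c) (Eventually.of_forall fun r =>
      le_of_tendsto (hlim r).norm (Eventually.of_forall fun n => hc n r))).trans ?_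
    gcongr
    exact ENNReal.toReal_le_of_le_ofReal (by positivity) (hμ x)

theorem exists_isOperatorIntegral [CompleteSpace H]
    (hμ : ∀ x, μ x Set.univ ≤ ENNReal.ofReal (‖x‖ ^ 2))
    (hind : ∀ s, MeasurableSet s → ∃ U : H →L[ℂ] H, ∀ x, inner ℂ x (U x) = (μ x).real s)
    {f : X → ℂ} (hf : Measurable f) {c : ℝ} (hc : ∀ r, ‖f r‖ ≤ c) :
    ∃ U, IsOperatorIntegral μ f U := by
  have hfin (x : H) : IsFiniteMeasure (μ x) := ⟨(hμ x).trans_lt ENNReal.ofReal_lt_top⟩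
  classical
  have hsimple (g : SimpleFunc X ℂ) : ∃ U, IsOperatorIntegral μ g U := by
    induction g using SimpleFunc.induction with
    | const c hs =>
      rename_i s
      obtain ⟨U, hU⟩ := hind s hs
      refine ⟨c • U, fun x => ?_⟩
      change inner ℂ x (c • U x) = _
      rw [inner_smul_right, hU, SimpleFunc.coe_piecewise, SimpleFunc.coe_const,
        SimpleFunc.coe_const]
      change _ = ∫ r, s.piecewise (fun _ => c) 0 r ∂(μ x)
      rw [Set.piecewise_eq_indicator, integral_indicator hs, setIntegral_const,
        Complex.real_smul, mul_comm]
    | add hd hf hg =>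
      obtain ⟨U, hU⟩ := hf
      obtain ⟨W, hW⟩ := hg
      exact ⟨U + W, hU.add hW (fun x => SimpleFunc.integrable_of_isFiniteMeasure _)
        fun x => SimpleFunc.integrable_of_isFiniteMeasure _⟩
  -- The bound `c` can only be negative if `X` is empty; `max c 0` covers that case.
  choose U hU using fun n => hsimple (hf.stronglyMeasurable.approxBounded (max c 0) n)
  exact exists_isOperatorIntegral_of_tendsto hμ (le_max_right c 0) (fun n => SimpleFunc.measurable _)
    (fun n r => hf.stronglyMeasurable.norm_approxBounded_le (le_max_right c 0) n r)
    (fun r => hf.stronglyMeasurable.tendsto_approxBounded_of_norm_le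
      ((hc r).trans (le_max_left c 0))) hU

end OperatorIntegral

end StandardModular

/-! ### Bounded functional calculus of a spectral measure -/

namespace StandardModular

open Filter Topology MeasureTheory

variable {H : Type*} [NormedAddCommGroup H] [InnerProductSpace ℂ H] [CompleteSpace H]

namespace SpectralMeasure

variable (E : SpectralMeasure H)

theorem inner_proj_symm {s : Set ℝ} (hs : MeasurableSet s) (x y : H) :
    inner ℂ (E.proj s x) y = inner ℂ x (E.proj s y) := by
  rw [← ContinuousLinearMap.adjoint_inner_right, ← ContinuousLinearMap.star_eq_adjoint,
    (E.isStarProjection s hs).isSelfAdjoint.star_eq]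

theorem proj_proj {s : Set ℝ} (hs : MeasurableSet s) (x : H) :
    E.proj s (E.proj s x) = E.proj s x :=
  DFunLike.congr_fun (E.isStarProjection s hs).isIdempotentElem.eq x

theorem inner_proj_self {s : Set ℝ} (hs : MeasurableSet s) (x : H) :
    inner ℂ x (E.proj s x) = ((E.measure x).real s : ℂ) := by
  have h : inner ℂ x (E.proj s x) = inner ℂ (E.proj s x) (E.proj s x) := by
    rw [E.inner_proj_symm hs, E.proj_proj hs]
  rw [Measure.real, E.measure_apply x hs, ENNReal.toReal_ofReal (E.re_inner_proj_nonneg hs x), h,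
    inner_self_eq_norm_sq_to_K]
  norm_cast

theorem measure_univ_le (x : H) : E.measure x Set.univ ≤ ENNReal.ofReal (‖x‖ ^ 2) := by
  rw [E.measure_apply x MeasurableSet.univ, E.proj_univ, one_apply_eq_self,
    ← inner_self_eq_norm_sq (𝕜 := ℂ), RCLike.re_to_complex]

instance isFiniteMeasure_measure (x : H) : IsFiniteMeasure (E.measure x) :=
  ⟨(E.measure_univ_le x).trans_lt ENNReal.ofReal_lt_top⟩

theorem measure_proj {s : Set ℝ} (hs : MeasurableSet s) (x : H) :
    E.measure (E.proj s x) = (E.measure x).restrict s := by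
  ext t ht
  rw [Measure.restrict_apply ht, E.measure_apply _ ht, E.measure_apply _ (ht.inter hs),
    E.inner_proj_symm hs, ← mul_apply_eq_comp, ← mul_apply_eq_comp, ← E.proj_inter _ _ hs ht,
    ← E.proj_inter _ _ (hs.inter ht) hs]
  congr 5
  ext; simp; tauto

theorem proj_eq_zero_iff {s : Set ℝ} (hs : MeasurableSet s) (x : H) :
    E.proj s x = 0 ↔ E.measure x s = 0 := by
  rw [← measureReal_eq_zero_iff]
  have h : inner ℂ (E.proj s x) (E.proj s x) = ((E.measure x).real s : ℂ) := by
    rw [E.inner_proj_symm hs, E.proj_proj hs, E.inner_proj_self hs]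
  constructor
  · intro h0
    rw [h0, inner_zero_left] at h
    exact_mod_cast h.symm
  · intro h0
    rw [h0, Complex.ofReal_zero, inner_self_eq_zero] at h
    exact h

theorem integrable_of_bounded {f : ℝ → ℂ} (hf : Measurable f) {c : ℝ} (hc : ∀ r, ‖f r‖ ≤ c)
    (x : H) : Integrable f (E.measure x) :=
  .of_bound hf.aestronglyMeasurable c (Eventually.of_forall hc)

theorem exists_isOperatorIntegral {f : ℝ → ℂ} (hf : Measurable f) {c : ℝ}
    (hc : ∀ r, ‖f r‖ ≤ c) : ∃ U, IsOperatorIntegral E.measure f U :=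
  StandardModular.exists_isOperatorIntegral E.measure_univ_le
    (fun s hs => ⟨E.proj s, E.inner_proj_self hs⟩) hf hc

variable {E}

theorem isOperatorIntegral_indicator {s : Set ℝ} (hs : MeasurableSet s) :
    IsOperatorIntegral E.measure (s.indicator 1) (E.proj s) := fun x => by
  rw [E.inner_proj_self hs, integral_indicator hs]
  simp

theorem isOperatorIntegral_proj_conj {f : ℝ → ℂ} {U : H →L[ℂ] H}
    (hU : IsOperatorIntegral E.measure f U) {s : Set ℝ} (hs : MeasurableSet s) :
    IsOperatorIntegral E.measure (s.indicator f) (E.proj s * U * E.proj s) := fun x => by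
  change inner ℂ x (E.proj s (U (E.proj s x))) = _
  rw [← E.inner_proj_symm hs, hU, E.measure_proj hs, integral_indicator hs]

/-- Splitting `f` over `s` and its complement and using uniqueness of the integral shows that `U` is
the sum of its compressions to the two ranges, so it is block diagonal. -/
theorem commute_proj {f : ℝ → ℂ} (hf : Measurable f) {c : ℝ} (hc : ∀ r, ‖f r‖ ≤ c)
    {U : H →L[ℂ] H} (hU : IsOperatorIntegral E.measure f U) {s : Set ℝ} (hs : MeasurableSet s) :
    Commute U (E.proj s) := by
  have h1 := isOperatorIntegral_proj_conj hU hs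
  have h2 := isOperatorIntegral_proj_conj hU hs.compl
  have hi (t : Set ℝ) (ht : MeasurableSet t) (x : H) : Integrable (t.indicator f) (E.measure x) :=
    (E.integrable_of_bounded hf hc x).indicator ht
  have h3 := h1.add h2 (hi s hs) (hi _ hs.compl)
  rw [Set.indicator_self_add_compl] at h3
  have h4 := hU.unique h3
  have h5 : E.proj s * E.proj s = E.proj s := (E.isStarProjection s hs).isIdempotentElem
  have h6 : E.proj s * E.proj sᶜ = 0 := by
    rw [← E.proj_inter _ _ hs hs.compl, Set.inter_compl_self, E.proj_empty]
  have h7 : E.proj sᶜ * E.proj s = 0 := by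
    rw [← E.proj_inter _ _ hs.compl hs, Set.compl_inter_self, E.proj_empty]
  have h8 : U * E.proj s = E.proj s * U * E.proj s := by
    conv_lhs => rw [h4, add_mul, mul_assoc _ _ (E.proj s), mul_assoc _ _ (E.proj s), h5, h7,
      mul_zero, add_zero]
  have h9 : E.proj s * U = E.proj s * U * E.proj s := by
    conv_lhs => rw [h4, mul_add, ← mul_assoc, ← mul_assoc, ← mul_assoc, ← mul_assoc, h5, h6,
      zero_mul, zero_mul, add_zero]
  exact h8.trans h9.symm

theorem isOperatorIntegral_mul_proj {f : ℝ → ℂ} (hf : Measurable f) {c : ℝ}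
    (hc : ∀ r, ‖f r‖ ≤ c) {U : H →L[ℂ] H} (hU : IsOperatorIntegral E.measure f U) {s : Set ℝ}
    (hs : MeasurableSet s) : IsOperatorIntegral E.measure (s.indicator f) (U * E.proj s) := by
  have h := isOperatorIntegral_proj_conj hU hs
  rwa [← (commute_proj hf hc hU hs).eq, mul_assoc,
    (E.isStarProjection s hs).isIdempotentElem.eq] at h

/-- Compression by projections settles indicators `g`, linearity settles simple ones. In the limit
`U` moves to the other side of the inner product as `star U`, so weak convergence of the
approximants suffices. -/
theorem isOperatorIntegral_mul {f g : ℝ → ℂ} (hf : Measurable f) {c : ℝ}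
    (hc : ∀ r, ‖f r‖ ≤ c) (hg : Measurable g) {c' : ℝ} (hc' : ∀ r, ‖g r‖ ≤ c')
    {U W : H →L[ℂ] H} (hU : IsOperatorIntegral E.measure f U)
    (hW : IsOperatorIntegral E.measure g W) :
    IsOperatorIntegral E.measure (fun r => f r * g r) (U * W) := by
  classical
  have hc0 : 0 ≤ c := (norm_nonneg _).trans (hc 0)
  have hc0' : 0 ≤ c' := (norm_nonneg _).trans (hc' 0)
  have hInt (k : SimpleFunc ℝ ℂ) (x : H) : Integrable (fun r => f r * k r) (E.measure x) :=
    (SimpleFunc.integrable_of_isFiniteMeasure k).bdd_mul hf.aestronglyMeasurable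
      (Eventually.of_forall hc)
  have hsimple (k : SimpleFunc ℝ ℂ) : ∃ W, IsOperatorIntegral E.measure k W ∧
      IsOperatorIntegral E.measure (fun r => f r * k r) (U * W) := by
    induction k using SimpleFunc.induction with
    | const a hs =>
      rename_i s
      refine ⟨a • E.proj s, ?_, ?_⟩
      · convert (isOperatorIntegral_indicator (E := E) hs).smul a using 1
        ext r
        by_cases hr : r ∈ s <;> simp [hr]
      · rw [mul_smul_comm]
        convert (isOperatorIntegral_mul_proj hf hc hU hs).smul a using 1
        ext r
        by_cases hr : r ∈ s <;> simp [hr, mul_comm]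
    | add hd hk hl =>
      rename_i k l
      obtain ⟨W, hW, hW'⟩ := hk
      obtain ⟨W₂, hW₂, hW₂'⟩ := hl
      refine ⟨W + W₂, hW.add hW₂ (fun x => SimpleFunc.integrable_of_isFiniteMeasure _)
        fun x => SimpleFunc.integrable_of_isFiniteMeasure _, ?_⟩
      rw [mul_add]
      convert hW'.add hW₂' (hInt k) (hInt l) using 1
      ext r
      simp [mul_add]
  set k := hg.stronglyMeasurable.approxBounded c'
  have hk (n : ℕ) (r : ℝ) : ‖k n r‖ ≤ c' := hg.stronglyMeasurable.norm_approxBounded_le hc0' n r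
  have hlim (r : ℝ) : Tendsto (fun n => k n r) atTop (𝓝 (g r)) :=
    hg.stronglyMeasurable.tendsto_approxBounded_of_norm_le (hc' r)
  choose W' hW1 hW2 using fun n => hsimple (k n)
  have h1 (x : H) : Tendsto (fun n => inner ℂ x (W' n x)) atTop (𝓝 (inner ℂ x (W x))) := by
    simp only [hW1 _ x, hW x]
    exact tendsto_integral_of_dominated_convergence (fun _ => c')
      (fun n => (k n).measurable.aestronglyMeasurable) (integrable_const c')
      (fun n => Eventually.of_forall (hk n)) (Eventually.of_forall hlim)
  intro x
  have h2 : Tendsto (fun n => inner ℂ x ((U * W' n) x)) atTop (𝓝 (inner ℂ x ((U * W) x))) := by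
    have h (T : H →L[ℂ] H) : inner ℂ x ((U * T) x) = inner ℂ (star U x) (T x) := by
      rw [mul_apply_eq_comp, ContinuousLinearMap.star_eq_adjoint,
        ContinuousLinearMap.adjoint_inner_left]
    simp only [h]
    exact tendsto_inner_of_tendsto_quadratic h1 _ _
  refine tendsto_nhds_unique h2 ?_
  simp only [hW2 _ x]
  exact tendsto_integral_of_dominated_convergence (fun _ => c * c')
      (fun n => (hf.mul (k n).measurable).aestronglyMeasurable) (integrable_const _)
      (fun n => Eventually.of_forall fun r => by
        rw [norm_mul]; exact mul_le_mul (hc r) (hk n r) (norm_nonneg _) hc0)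
      (Eventually.of_forall fun r => (hlim r).const_mul _)

theorem inner_map_map_eq_integral {f : ℝ → ℂ} (hf : Measurable f) {c : ℝ} (hc : ∀ r, ‖f r‖ ≤ c)
    {U : H →L[ℂ] H} (hU : IsOperatorIntegral E.measure f U) (x : H) :
    inner ℂ (U x) (U x) = ∫ r, ((‖f r‖ ^ 2 : ℝ) : ℂ) ∂(E.measure x) := by
  have h := isOperatorIntegral_mul (Complex.continuous_conj.measurable.comp hf) (c := c)
    (fun r => by rw [Function.comp_apply, RCLike.norm_conj]; exact hc r) hf hc hU.conj hU x
  rw [mul_apply_eq_comp, ContinuousLinearMap.star_eq_adjoint,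
    ContinuousLinearMap.adjoint_inner_right] at h
  rw [h]
  refine integral_congr_ae (Eventually.of_forall fun r => ?_)
  simp only [Function.comp_apply]
  rw [Complex.conj_mul']
  norm_cast

/-- As `U` commutes with `E(s)`, the mass of `s` is `‖U E(s) x‖²`, which is the integral of `|f|²`
over `s`. -/
theorem measure_map_eq_withDensity {f : ℝ → ℂ} (hf : Measurable f) {c : ℝ}
    (hc : ∀ r, ‖f r‖ ≤ c) {U : H →L[ℂ] H} (hU : IsOperatorIntegral E.measure f U) (x : H) :
    E.measure (U x) = (E.measure x).withDensity (fun r => ENNReal.ofReal (‖f r‖ ^ 2)) := by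
  ext s hs
  have hm : Measurable fun r => ‖f r‖ ^ 2 := hf.norm.pow_const 2
  have h1 : E.proj s (U x) = U (E.proj s x) :=
    (DFunLike.congr_fun (commute_proj hf hc hU hs) x).symm
  have h2 := inner_map_map_eq_integral hf hc hU (E.proj s x)
  have hInt (μ : Measure ℝ) [IsFiniteMeasure μ] : Integrable (fun r => ‖f r‖ ^ 2) μ :=
    .of_bound hm.aestronglyMeasurable (c ^ 2) (Eventually.of_forall fun r => by
      rw [Real.norm_of_nonneg (by positivity)]
      exact pow_le_pow_left₀ (norm_nonneg _) (hc r) 2)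
  rw [withDensity_apply _ hs, ← ofReal_integral_eq_lintegral_ofReal (hInt _)
    (Eventually.of_forall fun r => by positivity), E.measure_apply _ hs, ← E.proj_proj hs,
    ← E.inner_proj_symm hs, h1, h2, E.measure_proj hs, integral_complex_ofReal,
    Complex.ofReal_re]

end SpectralMeasure

end StandardModular

/-! ### Reduction to unitaries, and the spectral theorem for a bounded self-adjoint operator -/

namespace StandardModular

open Filter Topology MeasureTheory

variable {H : Type*} [NormedAddCommGroup H] [InnerProductSpace ℂ H] [CompleteSpace H]

section Unitary

open scoped ComplexStarModule

/-- An operator commuting with a star-closed set `S` commutes with every operator `B` that commutes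
with all unitaries in the commutant of `S`. -/
theorem commute_of_forall_unitary {S : Set (H →L[ℂ] H)} (hS : ∀ T ∈ S, star T ∈ S)
    {A B : H →L[ℂ] H} (hA : ∀ T ∈ S, Commute A T)
    (hB : ∀ u : unitary (H →L[ℂ] H), (∀ T ∈ S, Commute (u : H →L[ℂ] H) T) →
      Commute (u : H →L[ℂ] H) B) : Commute A B := by
  rcases eq_or_ne A 0 with rfl | hA0
  · exact Commute.zero_left B
  -- The four unitaries are `h ± i √(1 - h²)` for `h` the real and the imaginary part of `A / ‖A‖`;
  -- star-closedness of `S` keeps them in its commutant.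
  have h := CStarAlgebra.norm_smul_two_inv_smul_add_four_unitary A hA0
  have hAs (T) (hT : T ∈ S) : Commute (star A) T := by
    have := (hA _ (hS T hT)).star_star
    rwa [star_star] at this
  have hre (T) (hT : T ∈ S) : Commute (ℜ (‖A‖⁻¹ • A) : H →L[ℂ] H) T := by
    rw [realPart_apply_coe, star_smul]
    exact (((hA T hT).smul_left _).add_left ((hAs T hT).smul_left _)).smul_left _
  have him (T) (hT : T ∈ S) : Commute (ℑ (‖A‖⁻¹ • A) : H →L[ℂ] H) T := by
    rw [imaginaryPart_apply_coe, star_smul]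
    exact ((((hA T hT).smul_left _).sub_left ((hAs T hT).smul_left _)).smul_left _).smul_left _
  have hu (a : selfAdjoint (H →L[ℂ] H)) (ha : ‖a‖ ≤ 1)
      (hc : ∀ T ∈ S, Commute (a : H →L[ℂ] H) T) :
      Commute (selfAdjoint.unitarySelfAddISMul a ha : H →L[ℂ] H) B ∧
        Commute (star (selfAdjoint.unitarySelfAddISMul a ha) : H →L[ℂ] H) B := by
    have h1 (T) (hT : T ∈ S) : Commute (CFC.sqrt (1 - (a : H →L[ℂ] H) ^ 2)) T :=
      ((Commute.one_left T).sub_left ((hc T hT).pow_left 2)).cfcₙ_nnreal _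
    refine ⟨hB _ fun T hT => ?_, ?_⟩
    · rw [selfAdjoint.unitarySelfAddISMul_coe]
      exact (hc T hT).add_left ((h1 T hT).smul_left _)
    · rw [← Unitary.coe_star]
      refine hB _ fun T hT => ?_
      rw [Unitary.coe_star, selfAdjoint.star_coe_unitarySelfAddISMul]
      exact (hc T hT).sub_left ((h1 T hT).smul_left _)
  rw [h]
  obtain ⟨h1, h2⟩ := hu _ _ hre
  obtain ⟨h3, h4⟩ := hu _ _ him
  exact (((h1.add_left h2).add_left ((h3.add_left h4).smul_left _)).smul_left _).smul_left _

end Unitary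

section SpectralFamily

open CompactlySupported

variable {C : H →L[ℂ] H} (hC : IsSelfAdjoint C)

theorem inner_cfcHom_self (f : C(spectrum ℝ C, ℝ)) (x : H) :
    inner ℂ x (cfcHom hC f x) = ((inner ℂ x (cfcHom hC f x)).re : ℂ) := by
  have h : IsSelfAdjoint (cfcHom hC f) := cfcHom_predicate hC f
  refine (Complex.conj_eq_iff_re.mp ?_).symm
  rw [inner_conj_symm, ← ContinuousLinearMap.adjoint_inner_right,
    ← ContinuousLinearMap.star_eq_adjoint, h.star_eq]

/-- The positive functional `f ↦ ⟪x, f(C) x⟫` on continuous functions on the spectrum. -/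
noncomputable def spectralFunctional (x : H) : C_c(spectrum ℝ C, ℝ) →ₚ[ℝ] ℝ :=
  PositiveLinearMap.mk₀
    { toFun := fun f => (inner ℂ x (cfcHom hC f.toContinuousMap x)).re
      map_add' := fun f g => by
        have : (f + g).toContinuousMap = f.toContinuousMap + g.toContinuousMap := rfl
        rw [this, map_add, add_apply, inner_add_right, Complex.add_re]
      map_smul' := fun c f => by
        have : (c • f).toContinuousMap = c • f.toContinuousMap := rfl
        rw [this, map_smul, smul_apply, inner_smul_right_eq_smul]
        simp }
    fun f hf => re_inner_nonneg_of_nonneg ((cfcHom_nonneg_iff hC).mpr hf) x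

/-- The spectral measure of the self-adjoint operator `C` at the vector `x`. -/
noncomputable def spectralFamily (x : H) : Measure (spectrum ℝ C) :=
  RealRMK.rieszMeasure (spectralFunctional hC x)

theorem integral_spectralFamily (f : C(spectrum ℝ C, ℝ)) (x : H) :
    ∫ r, f r ∂(spectralFamily hC x) = (inner ℂ x (cfcHom hC f x)).re :=
  RealRMK.integral_rieszMeasure (spectralFunctional hC x)
    (CompactlySupportedContinuousMap.continuousMapEquiv f)

instance isFiniteMeasure_spectralFamily (x : H) : IsFiniteMeasure (spectralFamily hC x) := by
  unfold spectralFamily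
  infer_instance

theorem real_univ_spectralFamily (x : H) : (spectralFamily hC x).real Set.univ = ‖x‖ ^ 2 := by
  have h := integral_spectralFamily hC 1 x
  rw [map_one, one_apply_eq_self, ← RCLike.re_to_complex, inner_self_eq_norm_sq] at h
  simpa using h

theorem spectralFamily_eq {x y : H}
    (h : ∀ f : C(spectrum ℝ C, ℝ), (inner ℂ x (cfcHom hC f x)).re = (inner ℂ y (cfcHom hC f y)).re) :
    spectralFamily hC x = spectralFamily hC y := by
  unfold spectralFamily
  congr 1
  ext f
  exact h _

end SpectralFamily

end StandardModular

namespace StandardModular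

open Filter Topology MeasureTheory NNReal

variable {H : Type*} [NormedAddCommGroup H] [InnerProductSpace ℂ H] [CompleteSpace H]
  {C : H →L[ℂ] H} (hC : IsSelfAdjoint C)

theorem inner_cfcHom_eq_integral (f : C(spectrum ℝ C, ℝ)) (x : H) :
    inner ℂ x (cfcHom hC f x) = ((∫ r, f r ∂(spectralFamily hC x) : ℝ) : ℂ) := by
  rw [integral_spectralFamily, ← inner_cfcHom_self]

theorem measureReal_eq_integral_indicator {X : Type*} [MeasurableSpace X] (μ : Measure X)
    {s : Set X} (hs : MeasurableSet s) :
    ((μ.real s : ℝ) : ℂ) = ∫ r, s.indicator (1 : X → ℂ) r ∂μ := by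
  rw [integral_indicator hs]
  simp

/-- Induction over the π-system of closed sets. A closed set is reached by thickened indicators
inside the continuous functional calculus, a disjoint union by partial sums; both are limits of
quadratic forms bounded by `‖x‖²`. -/
theorem exists_spectralProjection {s : Set (spectrum ℝ C)} (hs : MeasurableSet s) :
    ∃ U : H →L[ℂ] H, ∀ x, inner ℂ x (U x) = ((spectralFamily hC x).real s : ℂ) := by
  have hgen : (inferInstance : MeasurableSpace (spectrum ℝ C)) =
      MeasurableSpace.generateFrom {s | IsClosed s} :=
    BorelSpace.measurable_eq.trans borel_eq_generateFrom_isClosed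
  induction s, hs using MeasurableSpace.induction_on_inter hgen isPiSystem_isClosed with
  | empty => exact ⟨0, fun x => by simp⟩
  | basic t ht =>
    have ht' : IsClosed t := ht
    refine exists_operator_of_tendsto_quadratic (l := atTop) (M := 1)
      (U := fun n : ℕ => cfcHom hC ⟨fun r => (thickenedIndicator
        (Nat.one_div_pos_of_nat (α := ℝ) (n := n)) t r : ℝ), by fun_prop⟩) (fun x => ?_) fun x => ?_
    · simp only [inner_cfcHom_eq_integral]
      exact (Complex.continuous_ofReal.tendsto _).comp
        (tendsto_integral_thickenedIndicator_of_isClosed (spectralFamily hC x) ht'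
          (fun n => Nat.one_div_pos_of_nat) tendsto_one_div_add_atTop_nhds_zero_nat)
    · rw [Complex.norm_real, Real.norm_of_nonneg measureReal_nonneg, one_mul,
        ← real_univ_spectralFamily hC x]
      exact measureReal_mono (Set.subset_univ _)
  | compl t ht ih =>
    obtain ⟨U, hU⟩ := ih
    refine ⟨1 - U, fun x => ?_⟩
    rw [sub_apply, one_apply_eq_self, inner_sub_right, hU, measureReal_compl ht,
      real_univ_spectralFamily, inner_self_eq_norm_sq_to_K]
    push_cast
    rfl
  | iUnion f hd hf ih =>
    choose U hU using ih
    refine exists_operator_of_tendsto_quadratic (l := atTop) (M := 1)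
      (U := fun n : ℕ => ∑ i ∈ Finset.range n, U i) (fun x => ?_) fun x => ?_
    · have h1 : HasSum (fun i => (spectralFamily hC x).real (f i))
          ((spectralFamily hC x).real (⋃ i, f i)) := by
        have h2 := measure_iUnion (μ := spectralFamily hC x) hd hf
        rw [Measure.real, h2, ENNReal.tsum_toReal_eq fun i => measure_ne_top _ _]
        refine (ENNReal.summable_toReal ?_).hasSum
        rw [← h2]
        exact measure_ne_top _ _
      have h3 := (Complex.continuous_ofReal.tendsto _).comp h1.tendsto_sum_nat
      refine h3.congr fun n => ?_
      simp only [Function.comp_apply, sum_apply, inner_sum, hU, Complex.ofReal_sum]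
    · rw [Complex.norm_real, Real.norm_of_nonneg measureReal_nonneg, one_mul,
        ← real_univ_spectralFamily hC x]
      exact measureReal_mono (Set.subset_univ _)

open Classical in
/-- The spectral projection of `C` for a Borel subset of the spectrum. -/
noncomputable def spectralProjection (s : Set (spectrum ℝ C)) : H →L[ℂ] H :=
  if hs : MeasurableSet s then (exists_spectralProjection hC hs).choose else 0

theorem inner_spectralProjection {s : Set (spectrum ℝ C)} (hs : MeasurableSet s) (x : H) :
    inner ℂ x (spectralProjection hC s x) = ((spectralFamily hC x).real s : ℂ) := by
  rw [spectralProjection, dif_pos hs]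
  exact (exists_spectralProjection hC hs).choose_spec x

/-- Commutation means `g* B g = B`, and an operator is determined by its quadratic form. This turns
commutation into invariance of measures. -/
theorem unitary_inner_comm {g : unitary (H →L[ℂ] H)} {B : H →L[ℂ] H} :
    Commute (g : H →L[ℂ] H) B ↔
      ∀ x, inner ℂ ((g : H →L[ℂ] H) x) (B ((g : H →L[ℂ] H) x)) = inner ℂ x (B x) := by
  have h1 (x y : H) : inner ℂ ((g : H →L[ℂ] H) x) y = inner ℂ x (star (g : H →L[ℂ] H) y) := by
    rw [ContinuousLinearMap.star_eq_adjoint, ContinuousLinearMap.adjoint_inner_right]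
  constructor
  · intro h x
    have h2 : B ((g : H →L[ℂ] H) x) = (g : H →L[ℂ] H) (B x) := (DFunLike.congr_fun h x).symm
    rw [h2, h1, ← mul_apply_eq_comp, Unitary.coe_star_mul_self, one_apply_eq_self]
  · intro h
    have h2 : star (g : H →L[ℂ] H) * (B * g) = B := eq_of_quadratic_eq fun x => by
      rw [← h x, h1]; rfl
    change (g : H →L[ℂ] H) * B = B * g
    conv_lhs => rw [← h2, ← mul_assoc, Unitary.mul_star_self_of_mem g.2, one_mul]

theorem spectralFamily_unitary {g : unitary (H →L[ℂ] H)} (hg : Commute (g : H →L[ℂ] H) C) (x : H) :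
    spectralFamily hC ((g : H →L[ℂ] H) x) = spectralFamily hC x :=
  spectralFamily_eq hC fun f => by
    have h : Commute (g : H →L[ℂ] H) (cfcHom hC f) :=
      (Commute.cfcHom hC hg.symm (by rw [hC.star_eq]; exact hg.symm) f).symm
    rw [unitary_inner_comm.mp h]

theorem commute_spectralProjection {A : H →L[ℂ] H} (hA : Commute A C) {s : Set (spectrum ℝ C)}
    (hs : MeasurableSet s) : Commute A (spectralProjection hC s) := by
  refine commute_of_forall_unitary (S := {C}) ?_ ?_ fun u hu => ?_
  · rintro _ rfl; exact hC.star_eq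
  · rintro _ rfl; exact hA
  · rw [unitary_inner_comm]
    intro x
    rw [inner_spectralProjection hC hs, inner_spectralProjection hC hs,
      spectralFamily_unitary hC (hu C rfl)]

theorem spectralProjection_nonneg (s : Set (spectrum ℝ C)) (hs : MeasurableSet s) :
    0 ≤ spectralProjection hC s := by
  rw [ContinuousLinearMap.nonneg_iff_isPositive, ContinuousLinearMap.isPositive_iff_complex]
  intro x
  have h := inner_spectralProjection hC hs x
  rw [← inner_conj_symm, h, Complex.conj_ofReal]
  exact ⟨by simp, by simp⟩

/-- If `T ≥ 0` commutes with `C` and `⟪x, f(C) T x⟫ = ∫ f w dν_x` for nonnegative continuous `f`,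
then the same holds for indicator functions. -/
theorem inner_spectralProjection_mul {T : H →L[ℂ] H} (hT : 0 ≤ T) (hTC : Commute T C)
    {w : spectrum ℝ C → ℝ≥0} (hw : Measurable w)
    (hTw : ∀ (f : C(spectrum ℝ C, ℝ≥0)) (x : H), ∫⁻ r, f r * w r ∂(spectralFamily hC x) =
      ENNReal.ofReal (inner ℂ x (cfcHom hC ⟨fun r => (f r : ℝ), by fun_prop⟩ (T x))).re)
    {s : Set (spectrum ℝ C)} (hs : MeasurableSet s) (x : H) :
    ENNReal.ofReal (inner ℂ x (spectralProjection hC s (T x))).re =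
      ∫⁻ r in s, w r ∂(spectralFamily hC x) := by
  have hB : 0 ≤ CFC.sqrt T := CFC.sqrt_nonneg T
  have hBB : CFC.sqrt T * CFC.sqrt T = T := CFC.sqrt_mul_sqrt_self T
  have hBC : Commute (CFC.sqrt T) C := hTC.cfcₙ_nnreal _
  set B := CFC.sqrt T
  have hin (A : H →L[ℂ] H) (hA : Commute B A) :
      inner ℂ (B x) (A (B x)) = inner ℂ x (A (T x)) := by
    rw [inner_symm_of_nonneg hB, ← hBB]
    congr 1
    exact DFunLike.congr_fun hA (B x)
  -- With `B = √T`, replacing `x` by `B x` absorbs `T` into the measure as the density `w`.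
  have hmeas : spectralFamily hC (B x) =
      (spectralFamily hC x).withDensity (fun r => (w r : ENNReal)) := by
    refine ext_of_forall_lintegral_eq_of_IsFiniteMeasure fun f => ?_
    rw [lintegral_withDensity_eq_lintegral_mul _ (by fun_prop) (by fun_prop)]
    have h1 := hTw ⟨f, f.continuous⟩ x
    rw [← hin _ ((Commute.cfcHom hC hBC.symm (by rw [hC.star_eq]; exact hBC.symm) _).symm),
      ← integral_spectralFamily] at h1
    have h2 : ∫⁻ r, f r ∂(spectralFamily hC (B x)) =
        ENNReal.ofReal (∫ r, (f r : ℝ) ∂(spectralFamily hC (B x))) := by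
      rw [ofReal_integral_eq_lintegral_ofReal]
      · simp
      · exact (f.integrable_of_nnreal _)
      · exact Eventually.of_forall fun r => (f r).2
    rw [h2]
    refine h1.symm.trans ?_
    simp [mul_comm]
  rw [← hin _ (commute_spectralProjection hC hBC hs), inner_spectralProjection hC hs,
    Complex.ofReal_re, ofReal_measureReal, hmeas, withDensity_apply _ hs]

end StandardModular

/-! ### Spectral measure with a prescribed resolvent -/

namespace StandardModular

open Filter Topology MeasureTheory NNReal

variable {H : Type*} [NormedAddCommGroup H] [InnerProductSpace ℂ H] [CompleteSpace H]
  {C : H →L[ℂ] H} (hC : IsSelfAdjoint C)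

omit [CompleteSpace H] in
theorem ofReal_re_inner_of_nonneg {A : H →L[ℂ] H} (hA : 0 ≤ A) (x : H) :
    (((inner ℂ x (A x)).re : ℝ) : ℂ) = inner ℂ x (A x) := by
  refine Complex.conj_eq_iff_re.mp ?_
  rw [inner_conj_symm, inner_symm_of_nonneg hA]

theorem lintegral_spectralFamily (f : C(spectrum ℝ C, ℝ≥0)) (x : H) :
    ∫⁻ r, f r ∂(spectralFamily hC x) =
      ENNReal.ofReal (inner ℂ x (cfcHom hC ⟨fun r => (f r : ℝ), by fun_prop⟩ x)).re := by
  rw [← integral_spectralFamily]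
  have hi : Integrable (fun r => (f r : ℝ)) (spectralFamily hC x) :=
    (BoundedContinuousFunction.mkOfCompact f).integrable_of_nnreal _
  have h := ofReal_integral_eq_lintegral_ofReal hi (Eventually.of_forall fun r => (f r).2)
  refine Eq.trans ?_ h.symm
  simp

theorem lintegral_indicator_spectralFamily (f : C(spectrum ℝ C, ℝ≥0)) {s : Set (spectrum ℝ C)}
    (hs : MeasurableSet s) (x : H) :
    ENNReal.ofReal (inner ℂ x (spectralProjection hC s
      (cfcHom hC ⟨fun r => (f r : ℝ), by fun_prop⟩ x))).re =
      ∫⁻ r in s, f r ∂(spectralFamily hC x) := by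
  set F : C(spectrum ℝ C, ℝ) := ⟨fun r => (f r : ℝ), by fun_prop⟩ with hF
  refine inner_spectralProjection_mul hC (T := cfcHom hC F) (w := f)
    ((cfcHom_nonneg_iff hC).mpr fun r => (f r).2) ?_ f.continuous.measurable (fun g x => ?_) hs x
  · exact Commute.cfcHom hC (Commute.refl C) (by rw [hC.star_eq]; exact Commute.refl C) F
  · have h := lintegral_spectralFamily hC (g * f) x
    have e : (⟨fun r => ((g * f) r : ℝ), by fun_prop⟩ : C(spectrum ℝ C, ℝ)) =
        ⟨fun r => (g r : ℝ), by fun_prop⟩ * F := by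
      ext r; simp [hF]
    rw [e, map_mul] at h
    simpa using h

/-- Multiplicativity is extended from continuous functions one factor at a time:
`lintegral_indicator_spectralFamily` handles an indicator against a continuous function, and feeding
it back with `T = E(t)` handles two indicators. -/
theorem spectralProjection_inter {s t : Set (spectrum ℝ C)} (hs : MeasurableSet s)
    (ht : MeasurableSet t) :
    spectralProjection hC (s ∩ t) = spectralProjection hC s * spectralProjection hC t := by
  have hsC (s : Set (spectrum ℝ C)) (hs : MeasurableSet s) :
      Commute (spectralProjection hC s) C :=
    (commute_spectralProjection hC (Commute.refl C) hs).symm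
  have hst : Commute (spectralProjection hC s) (spectralProjection hC t) :=
    commute_spectralProjection hC (hsC s hs) ht
  have hnn : 0 ≤ spectralProjection hC s * spectralProjection hC t :=
    hst.mul_nonneg (spectralProjection_nonneg hC s hs) (spectralProjection_nonneg hC t ht)
  refine eq_of_quadratic_eq fun x => ?_
  rw [inner_spectralProjection hC (hs.inter ht), ← ofReal_re_inner_of_nonneg hnn]
  congr 1
  have h := inner_spectralProjection_mul hC (spectralProjection_nonneg hC t ht) (hsC t ht)
    (w := t.indicator 1) (measurable_one.indicator ht) (fun f x => ?_) hs x
  · have h2 : ∫⁻ r in s, ((t.indicator (1 : spectrum ℝ C → ℝ≥0) r : ℝ≥0) : ENNReal)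
        ∂(spectralFamily hC x) = spectralFamily hC x (s ∩ t) := by
      have h3 : (fun r => ((t.indicator (1 : spectrum ℝ C → ℝ≥0) r : ℝ≥0) : ENNReal)) = t.indicator 1 := by
        ext r
        by_cases hr : r ∈ t <;> simp [hr]
      rw [h3, lintegral_indicator_one ht, Measure.restrict_apply ht, Set.inter_comm]
    rw [h2] at h
    rw [Measure.real, ← h, ENNReal.toReal_ofReal]
    · rfl
    · exact re_inner_nonneg_of_nonneg hnn x
  · have h1 := lintegral_indicator_spectralFamily hC f ht x
    have h2 : Commute (spectralProjection hC t)
        (cfcHom hC ⟨fun r => (f r : ℝ), by fun_prop⟩) :=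
      (Commute.cfcHom hC (hsC t ht).symm (by rw [hC.star_eq]; exact (hsC t ht).symm) _).symm
    rw [← mul_apply_eq_comp, ← h2.eq, mul_apply_eq_comp, h1, ← lintegral_indicator ht]
    refine lintegral_congr fun r => ?_
    by_cases hr : r ∈ t <;> simp [hr]

/-- The spectral measure on `ℝ` of the operator `k(C)`. -/
noncomputable def spectralMeasureMap {k : spectrum ℝ C → ℝ} (hk : Measurable k) :
    SpectralMeasure H where
  proj s := spectralProjection hC (k ⁻¹' s)
  isStarProjection s hs := by
    refine ⟨?_, (spectralProjection_nonneg hC _ (hk hs)).isSelfAdjoint⟩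
    change _ * _ = _
    rw [← spectralProjection_inter hC (hk hs) (hk hs), Set.inter_self]
  proj_univ := eq_of_quadratic_eq fun x => by
    rw [inner_spectralProjection hC (hk MeasurableSet.univ), Set.preimage_univ,
      real_univ_spectralFamily, one_apply_eq_self, inner_self_eq_norm_sq_to_K]
    push_cast
    rfl
  proj_inter s t hs ht := by
    rw [Set.preimage_inter, spectralProjection_inter hC (hk hs) (hk ht)]
  hasSum_proj s hs hd x := by
    set t : ℕ → Set (spectrum ℝ C) := fun n => k ⁻¹' s n
    have ht (n : ℕ) : MeasurableSet (t n) := hk (hs n)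
    have htd : Pairwise (Function.onFun Disjoint t) := fun i j hij => (hd hij).preimage k
    rw [Set.preimage_iUnion]
    have hsum : HasSum (fun i => (spectralFamily hC x).real (t i))
        ((spectralFamily hC x).real (⋃ i, t i)) := by
      have h2 := measure_iUnion (μ := spectralFamily hC x) htd ht
      rw [Measure.real, h2, ENNReal.tsum_toReal_eq fun i => measure_ne_top _ _]
      refine (ENNReal.summable_toReal ?_).hasSum
      rw [← h2]
      exact measure_ne_top _ _
    have hU : MeasurableSet (⋃ i, t i) := MeasurableSet.iUnion ht
    have hsa (s : Set (spectrum ℝ C)) (hs : MeasurableSet s) (x y : H) :=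
      inner_symm_of_nonneg (spectralProjection_nonneg hC s hs) x y
    have hmul (s t : Set (spectrum ℝ C)) (hs : MeasurableSet s) (ht : MeasurableSet t) (x y : H) :
        inner ℂ (spectralProjection hC s x) (spectralProjection hC t y) =
          inner ℂ x (spectralProjection hC (s ∩ t) y) := by
      rw [hsa s hs, spectralProjection_inter hC hs ht]
      rfl
    -- Orthogonality of the projections turns the squared distance into the measure not yet
    -- exhausted, so countable additivity of the scalar measure gives norm convergence.
    have hdist (F : Finset ℕ) : ‖∑ i ∈ F, spectralProjection hC (t i) x -
        spectralProjection hC (⋃ i, t i) x‖ ^ 2 =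
        (spectralFamily hC x).real (⋃ i, t i) - ∑ i ∈ F, (spectralFamily hC x).real (t i) := by
      have h1 (i : ℕ) : inner ℂ (spectralProjection hC (t i) x)
          (∑ j ∈ F, spectralProjection hC (t j) x) =
          if i ∈ F then ((spectralFamily hC x).real (t i) : ℂ) else 0 := by
        rw [inner_sum, ← Finset.sum_ite_eq F i
          (fun j => ((spectralFamily hC x).real (t j) : ℂ))]
        refine Finset.sum_congr rfl fun j _ => ?_
        rw [hmul _ _ (ht i) (ht j), inner_spectralProjection hC ((ht i).inter (ht j))]
        split_ifs with hij
        · rw [hij, Set.inter_self]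
        · rw [(htd hij).inter_eq]; simp
      have h2 (i : ℕ) : inner ℂ (spectralProjection hC (t i) x)
          (spectralProjection hC (⋃ i, t i) x) = ((spectralFamily hC x).real (t i) : ℂ) := by
        rw [hmul _ _ (ht i) hU, Set.inter_eq_left.mpr (Set.subset_iUnion t i),
          inner_spectralProjection hC (ht i)]
      have h3 (i : ℕ) : inner ℂ (spectralProjection hC (⋃ i, t i) x)
          (spectralProjection hC (t i) x) = ((spectralFamily hC x).real (t i) : ℂ) := by
        rw [← inner_conj_symm, h2, Complex.conj_ofReal]
      have h4 : inner ℂ (∑ i ∈ F, spectralProjection hC (t i) x -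
          spectralProjection hC (⋃ i, t i) x) (∑ i ∈ F, spectralProjection hC (t i) x -
          spectralProjection hC (⋃ i, t i) x) = (((spectralFamily hC x).real (⋃ i, t i) -
          ∑ i ∈ F, (spectralFamily hC x).real (t i) : ℝ) : ℂ) := by
        rw [inner_sub_left, inner_sub_right, inner_sub_right, sum_inner, sum_inner, inner_sum,
          hmul _ _ hU hU, Set.inter_self, inner_spectralProjection hC hU]
        simp only [h1, h2, h3, Finset.sum_ite_mem, Finset.inter_self]
        push_cast
        ring
      rw [inner_self_eq_norm_sq_to_K] at h4
      exact Complex.ofReal_injective ((Complex.ofReal_pow _ _).trans h4)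
    rw [HasSum, SummationFilter.unconditional_filter, tendsto_iff_norm_sub_tendsto_zero]
    have h5 : Tendsto (fun F : Finset ℕ => ‖∑ i ∈ F, spectralProjection hC (t i) x -
        spectralProjection hC (⋃ i, t i) x‖ ^ 2) atTop (𝓝 0) := by
      simp only [hdist]
      have h6 : Tendsto (fun F : Finset ℕ => ∑ i ∈ F, (spectralFamily hC x).real (t i)) atTop _ :=
        hsum
      have h7 := h6.const_sub ((spectralFamily hC x).real (⋃ i, t i))
      rwa [sub_self] at h7
    have h6 := h5.sqrt
    simpa using h6

theorem measure_spectralMeasureMap {k : spectrum ℝ C → ℝ} (hk : Measurable k) (x : H) :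
    (spectralMeasureMap hC hk).measure x = (spectralFamily hC x).map k := by
  ext s hs
  rw [SpectralMeasure.measure_apply _ _ hs, Measure.map_apply hk hs]
  change ENNReal.ofReal (inner ℂ x (spectralProjection hC (k ⁻¹' s) x)).re = _
  rw [inner_spectralProjection hC (hk hs), Complex.ofReal_re, ofReal_measureReal]

/-- The function `r ↦ (1 + r)⁻¹` on `[0, ∞)`. -/
noncomputable def resolventFun (r : ℝ) : ℝ := if 0 ≤ r then (1 + r)⁻¹ else 0

theorem measurable_resolventFun : Measurable resolventFun :=
  Measurable.ite measurableSet_Ici (by fun_prop) measurable_const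

theorem measurable_ofReal_resolventFun : Measurable fun r => (resolventFun r : ℂ) :=
  Complex.measurable_ofReal.comp measurable_resolventFun

theorem resolventFun_nonneg (r : ℝ) : 0 ≤ resolventFun r := by
  unfold resolventFun
  split_ifs with h <;> positivity

theorem resolventFun_le_one (r : ℝ) : resolventFun r ≤ 1 := by
  unfold resolventFun
  split_ifs with h
  · exact inv_le_one_of_one_le₀ (by linarith)
  · exact zero_le_one

theorem norm_resolventFun_le (r : ℝ) : ‖(resolventFun r : ℂ)‖ ≤ 1 := by
  rw [Complex.norm_real, Real.norm_of_nonneg (resolventFun_nonneg r)]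
  exact resolventFun_le_one r

theorem mul_resolventFun (r : ℝ) : r * resolventFun r = if 0 ≤ r then 1 - resolventFun r else 0 := by
  unfold resolventFun
  split_ifs with h
  · field_simp
    ring
  · rw [mul_zero]

theorem norm_mul_resolventFun_le (r : ℝ) : ‖((r * resolventFun r : ℝ) : ℂ)‖ ≤ 1 := by
  have h0 := resolventFun_nonneg r
  have h1 := resolventFun_le_one r
  rw [Complex.norm_real, mul_resolventFun, Real.norm_eq_abs, abs_le]
  split_ifs <;> constructor <;> linarith

theorem exists_spectralMeasure_resolvent (h0 : 0 ≤ C) (h1 : C ≤ 1) :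
    ∃ E : SpectralMeasure H, IsOperatorIntegral E.measure (fun r => (resolventFun r : ℂ)) C := by
  have hC : IsSelfAdjoint C := h0.isSelfAdjoint
  -- This is the inverse of `r ↦ (1 + r)⁻¹`. At `u = 0` it takes the value `-1`, where
  -- `resolventFun` is `0`, so the identity survives there too.
  have hk : Measurable fun u : spectrum ℝ C => (u : ℝ)⁻¹ - 1 := by fun_prop
  refine ⟨spectralMeasureMap hC hk, fun x => ?_⟩
  rw [measure_spectralMeasureMap, integral_map hk.aemeasurable
    measurable_ofReal_resolventFun.aestronglyMeasurable]
  have h2 := inner_cfcHom_eq_integral hC ((ContinuousMap.id ℝ).restrict (spectrum ℝ C)) x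
  rw [cfcHom_id, ← integral_complex_ofReal] at h2
  rw [h2]
  refine integral_congr_ae (Eventually.of_forall fun u => ?_)
  have hu0 : 0 ≤ (u : ℝ) := spectrum_nonneg_of_nonneg (𝕜 := ℝ) h0 u.2
  have hu1 : (u : ℝ) ≤ 1 := by
    have h3 : ‖C‖ ≤ 1 := (CStarAlgebra.norm_le_one_iff_of_nonneg C h0).mpr h1
    have : Nontrivial H := by
      by_contra hH
      rw [not_nontrivial_iff_subsingleton] at hH
      have : Subsingleton (H →L[ℂ] H) := inferInstance
      exact (spectrum.of_subsingleton (R := ℝ) C).subset u.2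
    exact (le_abs_self _).trans ((spectrum.norm_le_norm_of_mem u.2).trans h3)
  simp only [ContinuousMap.restrict_apply, ContinuousMap.id_apply, resolventFun]
  rcases hu0.eq_or_lt with hu | hu
  · rw [← hu]; norm_num
  · rw [if_pos (by rw [sub_nonneg]; exact (one_le_inv₀ hu).mpr hu1)]
    congr 1
    rw [add_sub_cancel, inv_inv]

end StandardModular

/-! ### Any spectral measure of `Δ_V` has resolvent `a²` -/

namespace StandardModular

open Filter Topology MeasureTheory NNReal

variable {H : Type*} [NormedAddCommGroup H] [InnerProductSpace ℂ H] [CompleteSpace H]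

namespace SpectralMeasure

variable {E : SpectralMeasure H}

theorem integrable_measure_map_iff {f : ℝ → ℂ} (hf : Measurable f) {c : ℝ}
    (hc : ∀ r, ‖f r‖ ≤ c) {U : H →L[ℂ] H} (hU : IsOperatorIntegral E.measure f U) (x : H)
    {F : Type*} [NormedAddCommGroup F] [NormedSpace ℝ F] {g : ℝ → F} :
    Integrable g (E.measure (U x)) ↔ Integrable (fun r => ‖f r‖ ^ 2 • g r) (E.measure x) := by
  rw [measure_map_eq_withDensity hf hc hU,
    integrable_withDensity_iff_integrable_smul' (by fun_prop)
      (Eventually.of_forall fun r => ENNReal.ofReal_lt_top)]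
  simp only [ENNReal.toReal_ofReal (sq_nonneg ‖f _‖)]

theorem integral_measure_map {f : ℝ → ℂ} (hf : Measurable f) {c : ℝ}
    (hc : ∀ r, ‖f r‖ ≤ c) {U : H →L[ℂ] H} (hU : IsOperatorIntegral E.measure f U) (x : H)
    {F : Type*} [NormedAddCommGroup F] [NormedSpace ℝ F] (g : ℝ → F) :
    ∫ r, g r ∂(E.measure (U x)) = ∫ r, ‖f r‖ ^ 2 • g r ∂(E.measure x) := by
  rw [measure_map_eq_withDensity hf hc hU, integral_withDensity_eq_integral_toReal_smul
    (by fun_prop) (Eventually.of_forall fun r => ENNReal.ofReal_lt_top)]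
  simp only [ENNReal.toReal_ofReal (sq_nonneg ‖f _‖)]

theorem eq_zero_of_measure_eq_zero {x : H} (h : E.measure x Set.univ = 0) : x = 0 := by
  have h1 := (E.proj_eq_zero_iff MeasurableSet.univ x).mpr h
  rwa [E.proj_univ] at h1

end SpectralMeasure

theorem norm_sq_mul_resolventFun_sq_le (r : ℝ) :
    ‖‖(resolventFun r : ℂ)‖ ^ 2 • r ^ 2‖ ≤ 1 := by
  have h := norm_mul_resolventFun_le r
  rw [Complex.norm_real] at h ⊢
  rw [smul_eq_mul, ← mul_pow, norm_pow, norm_mul, norm_norm, mul_comm, ← norm_mul]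
  exact pow_le_one₀ (norm_nonneg _) h

theorem SpectralMeasure.integrable_sq_of_isOperatorIntegral {E : SpectralMeasure H} {Y : H →L[ℂ] H}
    (hY : IsOperatorIntegral E.measure (fun r => (resolventFun r : ℂ)) Y) (x : H) :
    Integrable (fun r : ℝ => r ^ 2) (E.measure (Y x)) := by
  rw [SpectralMeasure.integrable_measure_map_iff measurable_ofReal_resolventFun
    norm_resolventFun_le hY]
  exact .of_bound (((measurable_ofReal_resolventFun.norm.pow_const 2).smul
    (measurable_id.pow_const 2)).aestronglyMeasurable) 1
    (Eventually.of_forall norm_sq_mul_resolventFun_sq_le)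

namespace BoundedModularData

variable {V : StandardSubspace H} (d : BoundedModularData V) {E : SpectralMeasure H}

include d

omit [CompleteSpace H] in
theorem apply_mem_graph {x : H} (hx : x ∈ (modularOperator V).domain) :
    ∃ q, x = d.a (d.a q) ∧ modularOperator V ⟨x, hx⟩ = d.b (d.b q) :=
  d.mem_graph_modularOperator.mp ((modularOperator V).mem_graph ⟨x, hx⟩)

/-- For `y = E([-n, 0]) x = a² q` the form `⟪y, Δ_V y⟫` is an integral of nonpositive values and
also `‖b a q‖²`. So `b a q = 0`, and injectivity of `b` excludes even an atom at `0`. -/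
theorem measure_Iic_eq_zero (hE : E.Represents (modularOperator V)) (x : H) :
    E.measure x (Set.Iic 0) = 0 := by
  have hn (n : ℕ) : E.measure x (Set.Icc (-(n : ℝ)) 0) = 0 := by
    have hs : MeasurableSet (Set.Icc (-(n : ℝ)) 0) := measurableSet_Icc
    rw [← E.proj_eq_zero_iff hs]
    set y := E.proj (Set.Icc (-(n : ℝ)) 0) x with hy
    have hm : E.measure y = (E.measure x).restrict (Set.Icc (-(n : ℝ)) 0) := E.measure_proj hs x
    have hyd : y ∈ (modularOperator V).domain := by
      rw [hE.1, hm]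
      exact (by fun_prop : Continuous fun r : ℝ => r ^ 2).continuousOn.integrableOn_compact
        isCompact_Icc
    obtain ⟨q, hq, hq'⟩ := d.apply_mem_graph hyd
    have h1 := hE.2 ⟨y, hyd⟩
    rw [hq'] at h1
    change inner ℂ y _ = ∫ r : ℝ, (r : ℂ) ∂(E.measure y) at h1
    rw [hm, integral_complex_ofReal] at h1
    have h2 : inner ℂ y (d.b (d.b q)) = inner ℂ (d.b (d.a q)) (d.b (d.a q)) := by
      rw [hq, ← d.inner_b, ← d.a_b, d.inner_a, d.a_b]
    have h3 : ∫ r in Set.Icc (-(n : ℝ)) 0, r ∂(E.measure x) ≤ 0 :=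
      setIntegral_nonpos hs fun r hr => hr.2
    have h4 := congrArg Complex.re h1
    rw [h2, Complex.ofReal_re] at h4
    have h5 : d.b (d.a q) = 0 := by
      rw [← norm_eq_zero, ← sq_eq_zero_iff, ← inner_self_eq_norm_sq (𝕜 := ℂ), RCLike.re_to_complex]
      exact le_antisymm (h4.trans_le h3) (inner_self_nonneg (𝕜 := ℂ))
    rw [hq, d.b_injective _ h5, map_zero]
  refine measure_mono_null ?_ (measure_iUnion_null hn)
  intro r hr
  obtain ⟨n, hn⟩ := exists_nat_ge (-r)
  exact Set.mem_iUnion.mpr ⟨n, by linarith, hr⟩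

theorem ae_pos (hE : E.Represents (modularOperator V)) (x : H) : ∀ᵐ r ∂(E.measure x), 0 < r := by
  have h := d.measure_Iic_eq_zero hE x
  rw [ae_iff]
  convert h using 2
  ext r
  simp

theorem isOperatorIntegral_resolventFun (hE : E.Represents (modularOperator V)) :
    IsOperatorIntegral E.measure (fun r => (resolventFun r : ℂ)) (d.a * d.a) := by
  have hZm : Measurable fun r : ℝ => ((r * resolventFun r : ℝ) : ℂ) :=
    Complex.measurable_ofReal.comp (measurable_id.mul measurable_resolventFun)
  obtain ⟨Y, hY⟩ := E.exists_isOperatorIntegral measurable_ofReal_resolventFun norm_resolventFun_le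
  obtain ⟨Z, hZ⟩ := E.exists_isOperatorIntegral hZm norm_mul_resolventFun_le
  have hYs : star Y = Y := by
    have h := hY.conj
    simp only [Complex.conj_ofReal] at h
    exact h.unique hY
  have hYin (x y : H) : inner ℂ (Y x) y = inner ℂ x (Y y) := by
    rw [← ContinuousLinearMap.adjoint_inner_right, ← ContinuousLinearMap.star_eq_adjoint, hYs]
  have hYZ : Y + Z = 1 := eq_of_quadratic_eq fun x => by
    have h := hY.add hZ (fun x => E.integrable_of_bounded measurable_ofReal_resolventFun
      norm_resolventFun_le x) (fun x => E.integrable_of_bounded hZm norm_mul_resolventFun_le x) x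
    rw [h, ← E.proj_univ, E.inner_proj_self MeasurableSet.univ,
      measureReal_eq_integral_indicator _ MeasurableSet.univ]
    refine integral_congr_ae ((d.ae_pos hE x).mono fun r hr => ?_)
    simp only [Pi.add_apply, mul_resolventFun, if_pos hr.le, Set.indicator_univ, Pi.one_apply]
    push_cast
    ring
  have hYinj (x : H) (hx : Y x = 0) : x = 0 := by
    have h := SpectralMeasure.measure_map_eq_withDensity measurable_ofReal_resolventFun
      norm_resolventFun_le hY x
    have h0 : E.measure (Y x) = 0 := by
      rw [← Measure.measure_univ_eq_zero, hx, ← E.proj_eq_zero_iff MeasurableSet.univ, map_zero]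
    rw [h0, eq_comm, withDensity_eq_zero_iff
      (measurable_ofReal_resolventFun.norm.pow_const 2).ennreal_ofReal.aemeasurable] at h
    refine SpectralMeasure.eq_zero_of_measure_eq_zero (E := E) ?_
    rw [Measure.measure_univ_eq_zero, ← ae_eq_bot, ← eventually_false_iff_eq_bot]
    filter_upwards [h, d.ae_pos hE x] with r hr hr0
    rw [Pi.zero_apply, ENNReal.ofReal_eq_zero, Complex.norm_real, resolventFun, if_pos hr0.le] at hr
    have h1 : 0 < 1 + r := by linarith
    have : 0 < ‖(1 + r)⁻¹‖ ^ 2 := pow_pos (norm_pos_iff.mpr (inv_pos.mpr h1).ne') 2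
    linarith
  have hdom (x : H) : Y x ∈ (modularOperator V).domain := by
    rw [hE.1]; exact SpectralMeasure.integrable_sq_of_isOperatorIntegral hY x
  let L : H →ₗ[ℂ] H := (modularOperator V).toFun ∘ₗ Y.toLinearMap.codRestrict _ hdom
  have hL (x : H) : L x = modularOperator V ⟨Y x, hdom x⟩ := rfl
  -- `Represents` controls only the quadratic form of `Δ_V`; evaluated at `Y x` it shows that `Y (ΔY
  -- - Z)` has zero form. Since `Y` is injective, `ΔY = Z`.
  have hLZ (x : H) : inner ℂ (Y x) (L x) = inner ℂ (Y x) (Z x) := by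
    have h1 := hE.2 ⟨Y x, hdom x⟩
    rw [hL, h1, hYin]
    have h2 := SpectralMeasure.isOperatorIntegral_mul measurable_ofReal_resolventFun
      norm_resolventFun_le hZm norm_mul_resolventFun_le hY hZ x
    change _ = inner ℂ x ((Y * Z) x)
    rw [h2]
    change ∫ r : ℝ, (r : ℂ) ∂(E.measure (Y x)) = _
    rw [SpectralMeasure.integral_measure_map measurable_ofReal_resolventFun
      norm_resolventFun_le hY]
    refine integral_congr_ae (Eventually.of_forall fun r => ?_)
    simp only [Complex.norm_real, Complex.real_smul, Real.norm_eq_abs, sq_abs]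
    push_cast
    ring
  have hM : Y.toLinearMap ∘ₗ (L - Z.toLinearMap) = 0 := by
    rw [← inner_map_self_eq_zero]
    intro x
    change inner ℂ (Y (L x - Z x)) x = 0
    rw [hYin, inner_sub_left, ← inner_conj_symm (L x), ← inner_conj_symm (Z x), hLZ, sub_self]
  have hYa : Y = d.a * d.a := by
    ext x
    have h1 : L x = Z x := sub_eq_zero.mp (hYinj _ (LinearMap.congr_fun hM x))
    obtain ⟨q, hq, hq'⟩ := d.apply_mem_graph (hdom x)
    -- The point `(Y x, Δ Y x)` of the graph has parameter `q = Y x + Z x = x`.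
    have h2 : q = x := by
      rw [← d.sq_apply q, ← hq, ← hq', ← hL, h1]
      exact DFunLike.congr_fun hYZ x
    rw [hq, h2]
    rfl
  exact hYa ▸ hY

end BoundedModularData

end StandardModular

/-! ### Uniqueness of the spectral measure through moments -/

namespace StandardModular

open Filter Topology MeasureTheory NNReal

/-- Hausdorff's moment argument: the values lie in `[0, 1]`, where polynomials approximate
continuous functions uniformly. -/
theorem measure_map_eq_of_moments {X : Type*} [MeasurableSpace X] {μ ν : Measure X}
    [IsFiniteMeasure μ] [IsFiniteMeasure ν] {g : X → ℝ} (hg : Measurable g) (h0 : ∀ r, 0 ≤ g r)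
    (h1 : ∀ r, g r ≤ 1) (h : ∀ n : ℕ, ∫ r, g r ^ n ∂μ = ∫ r, g r ^ n ∂ν) :
    μ.map g = ν.map g := by
  have hb (r : X) (n : ℕ) : ‖g r ^ n‖ ≤ 1 := by
    rw [norm_pow, Real.norm_of_nonneg (h0 r)]
    exact pow_le_one₀ (h0 r) (h1 r)
  have hInt (ρ : Measure X) [IsFiniteMeasure ρ] (n : ℕ) : Integrable (fun r => g r ^ n) ρ :=
    .of_bound (hg.pow_const n).aestronglyMeasurable 1 (Eventually.of_forall fun r => hb r n)
  have hpint (ρ : Measure X) [IsFiniteMeasure ρ] (p : Polynomial ℝ) :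
      Integrable (fun r => p.eval (g r)) ρ := by
    simp only [Polynomial.eval_eq_sum_range]
    exact integrable_finsetSum _ fun n _ => (hInt ρ n).const_mul _
  have hp (p : Polynomial ℝ) : ∫ r, p.eval (g r) ∂μ = ∫ r, p.eval (g r) ∂ν := by
    simp only [Polynomial.eval_eq_sum_range]
    rw [integral_finsetSum _ fun n _ => (hInt μ n).const_mul _,
      integral_finsetSum _ fun n _ => (hInt ν n).const_mul _]
    simp only [integral_const_mul, h]
  have hfint (ρ : Measure X) [IsFiniteMeasure ρ] (f : BoundedContinuousFunction ℝ ℝ) :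
      Integrable (fun r => f (g r)) ρ :=
    .of_bound (f.continuous.measurable.comp hg).aestronglyMeasurable ‖f‖
      (Eventually.of_forall fun r => f.norm_coe_le_norm _)
  refine ext_of_forall_integral_eq_of_IsFiniteMeasure fun f => ?_
  rw [integral_map hg.aemeasurable f.continuous.aestronglyMeasurable,
    integral_map hg.aemeasurable f.continuous.aestronglyMeasurable]
  have key (ε : ℝ) (hε : 0 < ε) :
      ‖(∫ r, f (g r) ∂μ) - ∫ r, f (g r) ∂ν‖ ≤ ε * (μ.real Set.univ + ν.real Set.univ) := by
    obtain ⟨p, hpf⟩ := exists_polynomial_near_of_continuousOn 0 1 f f.continuous.continuousOn ε hε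
    have hd (ρ : Measure X) [IsFiniteMeasure ρ] :
        ‖(∫ r, f (g r) ∂ρ) - ∫ r, p.eval (g r) ∂ρ‖ ≤ ε * ρ.real Set.univ := by
      rw [← integral_sub (hfint ρ f) (hpint ρ p)]
      refine norm_integral_le_of_norm_le_const (Eventually.of_forall fun r => ?_)
      rw [norm_sub_rev]
      exact (hpf _ ⟨h0 r, h1 r⟩).le
    have h2 := hd μ
    have h3 := hd ν
    rw [hp p] at h2
    rw [norm_sub_rev] at h3
    calc _ ≤ _ := norm_sub_le_norm_sub_add_norm_sub _ (∫ r, p.eval (g r) ∂ν) _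
      _ ≤ _ := by rw [mul_add]; exact add_le_add h2 h3
  refine sub_eq_zero.mp (norm_eq_zero.mp (le_antisymm ?_ (norm_nonneg _)))
  refine ge_of_tendsto (x := 𝓝[>] (0 : ℝ))
    (f := fun ε => ε * (μ.real Set.univ + ν.real Set.univ)) ?_
    (eventually_mem_nhdsWithin.mono key)
  have : Tendsto (fun ε : ℝ => ε * (μ.real Set.univ + ν.real Set.univ)) (𝓝 0)
    (𝓝 (0 * (μ.real Set.univ + ν.real Set.univ))) := tendsto_id.mul_const _
  rw [zero_mul] at this
  exact this.mono_left nhdsWithin_le_nhds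

theorem inv_resolventFun_sub_one {r : ℝ} (hr : 0 ≤ r) : (resolventFun r)⁻¹ - 1 = r := by
  rw [resolventFun, if_pos hr, inv_inv, add_sub_cancel_left]

theorem map_map_resolventFun {μ : Measure ℝ} (h : μ (Set.Iio 0) = 0) :
    (μ.map resolventFun).map (fun u => u⁻¹ - 1) = μ := by
  rw [Measure.map_map (by fun_prop) measurable_resolventFun]
  conv_rhs => rw [← Measure.map_id (μ := μ)]
  refine Measure.map_congr ?_
  have : ∀ᵐ r ∂μ, ¬ r < 0 := measure_eq_zero_iff_ae_notMem.mp h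
  filter_upwards [this] with r hr
  exact inv_resolventFun_sub_one (not_lt.mp hr)

variable {H : Type*} [NormedAddCommGroup H] [InnerProductSpace ℂ H] [CompleteSpace H]

namespace SpectralMeasure

variable {E E' : SpectralMeasure H} {C : H →L[ℂ] H}

theorem measure_Iio_eq_zero (hE : IsOperatorIntegral E.measure (fun r => (resolventFun r : ℂ)) C)
    (hC : ∀ x, C x = 0 → x = 0) (x : H) : E.measure x (Set.Iio 0) = 0 := by
  have h := isOperatorIntegral_mul_proj measurable_ofReal_resolventFun norm_resolventFun_le hE
    (measurableSet_Iio (a := (0 : ℝ)))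
  have h0 : C * E.proj (Set.Iio 0) = 0 := eq_of_quadratic_eq fun x => by
    rw [h]
    have : (Set.Iio (0 : ℝ)).indicator (fun r => (resolventFun r : ℂ)) = 0 := by
      ext r
      by_cases hr : r < 0
      · simp [hr, resolventFun, not_le.mpr hr]
      · simp [hr]
    simp [this]
  rw [← E.proj_eq_zero_iff measurableSet_Iio]
  exact hC _ (DFunLike.congr_fun h0 x)

theorem isOperatorIntegral_resolventFun_pow
    (hE : IsOperatorIntegral E.measure (fun r => (resolventFun r : ℂ)) C) (n : ℕ) :
    IsOperatorIntegral E.measure (fun r => (resolventFun r : ℂ) ^ n) (C ^ n) := by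
  induction n with
  | zero =>
    intro x
    rw [pow_zero, ← E.proj_univ, E.inner_proj_self MeasurableSet.univ,
      measureReal_eq_integral_indicator _ MeasurableSet.univ]
    simp
  | succ n ih =>
    simp only [pow_succ]
    exact isOperatorIntegral_mul (measurable_ofReal_resolventFun.pow_const n) (c := 1)
      (fun r => by
        rw [norm_pow]; exact pow_le_one₀ (norm_nonneg _) (norm_resolventFun_le r))
      measurable_ofReal_resolventFun norm_resolventFun_le ih hE

/-- The form of `Cⁿ` is the `n`-th moment of `(1 + r)⁻¹`, and on `[0, ∞)` this function is inverted
by `u ↦ u⁻¹ - 1`. Two measures and two vectors are allowed so that both uniqueness and unitary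
invariance follow. -/
theorem measure_eq_of_inner_pow_eq
    (hE : IsOperatorIntegral E.measure (fun r => (resolventFun r : ℂ)) C)
    (hE' : IsOperatorIntegral E'.measure (fun r => (resolventFun r : ℂ)) C)
    (hC : ∀ x, C x = 0 → x = 0) {x y : H}
    (h : ∀ n : ℕ, inner ℂ x ((C ^ n) x) = inner ℂ y ((C ^ n) y)) :
    E.measure x = E'.measure y := by
  rw [← map_map_resolventFun (measure_Iio_eq_zero hE hC x),
    ← map_map_resolventFun (measure_Iio_eq_zero hE' hC y),
    measure_map_eq_of_moments measurable_resolventFun resolventFun_nonneg resolventFun_le_one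
      (μ := E.measure x) (ν := E'.measure y)]
  intro n
  have h1 := h n
  rw [isOperatorIntegral_resolventFun_pow hE n x, isOperatorIntegral_resolventFun_pow hE' n y] at h1
  simp only [← Complex.ofReal_pow, integral_complex_ofReal] at h1
  exact_mod_cast h1

theorem measure_unitary {g : unitary (H →L[ℂ] H)}
    (hE : IsOperatorIntegral E.measure (fun r => (resolventFun r : ℂ)) C)
    (hC : ∀ x, C x = 0 → x = 0) (hg : Commute (g : H →L[ℂ] H) C) (x : H) :
    E.measure ((g : H →L[ℂ] H) x) = E.measure x :=
  measure_eq_of_inner_pow_eq hE hE hC fun n => unitary_inner_comm.mp (hg.pow_right n) x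

theorem measure_eq
    (hE : IsOperatorIntegral E.measure (fun r => (resolventFun r : ℂ)) C)
    (hE' : IsOperatorIntegral E'.measure (fun r => (resolventFun r : ℂ)) C)
    (hC : ∀ x, C x = 0 → x = 0) (x : H) : E.measure x = E'.measure x :=
  measure_eq_of_inner_pow_eq hE hE' hC fun _ => rfl

end SpectralMeasure

end StandardModular

/-! ### A spectral measure with resolvent `a²` represents `Δ_V` -/

namespace StandardModular

open Filter Topology MeasureTheory NNReal

variable {H : Type*} [NormedAddCommGroup H] [InnerProductSpace ℂ H] [CompleteSpace H]

namespace SpectralMeasure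

variable {E : SpectralMeasure H} {C : H →L[ℂ] H}

theorem tendsto_inner_proj_Icc (hE : ∀ x, E.measure x (Set.Iio 0) = 0) (x y : H) :
    Tendsto (fun n : ℕ => inner ℂ x (E.proj (Set.Icc 0 (n : ℝ)) y)) atTop (𝓝 (inner ℂ x y)) := by
  refine tendsto_inner_of_tendsto_quadratic (W := 1) (fun x => ?_) x y
  rw [← E.proj_univ, E.inner_proj_self MeasurableSet.univ]
  simp only [E.inner_proj_self measurableSet_Icc]
  refine (Complex.continuous_ofReal.tendsto _).comp ?_
  have hm : Monotone fun n : ℕ => Set.Icc 0 (n : ℝ) := fun n m h =>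
    Set.Icc_subset_Icc_right (by exact_mod_cast h)
  have h := tendsto_measure_iUnion_atTop (μ := E.measure x) hm
  have hu : E.measure x (⋃ n : ℕ, Set.Icc 0 (n : ℝ)) = E.measure x Set.univ := by
    refine measure_congr (eventuallyEq_univ.mpr ?_)
    have : ∀ᵐ r ∂(E.measure x), ¬ r < 0 := measure_eq_zero_iff_ae_notMem.mp (hE x)
    filter_upwards [this] with r hr
    obtain ⟨n, hn⟩ := exists_nat_ge r
    exact Set.mem_iUnion.mpr ⟨n, not_lt.mp hr, hn⟩
  rw [hu] at h
  exact (ENNReal.tendsto_toReal (measure_ne_top _ _)).comp h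

/-- The preimage is `(1 + r)` applied to `x`: the truncations `U n` to `[0, n]` satisfy `C U n =
E([0, n])`, and `U n x` is Cauchy because the tails of `∫ (1 + r)² dμ_x` vanish. -/
theorem exists_apply_eq_of_integrable_sq
    (hE : IsOperatorIntegral E.measure (fun r => (resolventFun r : ℂ)) C)
    (hC : ∀ x, C x = 0 → x = 0) {x : H} (hx : Integrable (fun r : ℝ => r ^ 2) (E.measure x)) :
    ∃ y, C y = x := by
  let f : ℕ → ℝ → ℂ := fun n => (Set.Icc 0 (n : ℝ)).indicator fun r => ((1 + r : ℝ) : ℂ)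
  have hf (n : ℕ) : Measurable (f n) :=
    Measurable.indicator (by fun_prop) measurableSet_Icc
  have hfb (n : ℕ) (r : ℝ) : ‖f n r‖ ≤ 1 + n := by
    by_cases h : r ∈ Set.Icc 0 (n : ℝ)
    · simp only [f, Set.indicator_of_mem h, Complex.norm_real]
      rw [Real.norm_of_nonneg (by linarith [h.1])]
      linarith [h.2]
    · simp only [f, Set.indicator_of_notMem h, norm_zero]
      positivity
  choose U hU using fun n => E.exists_isOperatorIntegral (hf n) (hfb n)
  have hCU (n : ℕ) : C * U n = E.proj (Set.Icc 0 (n : ℝ)) := by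
    refine IsOperatorIntegral.unique (isOperatorIntegral_mul measurable_ofReal_resolventFun
      norm_resolventFun_le (hf n) (hfb n) hE (hU n)) ?_
    convert isOperatorIntegral_indicator measurableSet_Icc using 2 with r
    by_cases h : r ∈ Set.Icc 0 (n : ℝ)
    · simp only [f, Set.indicator_of_mem h, resolventFun, if_pos h.1, Pi.one_apply]
      rw [← Complex.ofReal_mul, inv_mul_cancel₀ (by linarith [h.1]), Complex.ofReal_one]
    · simp only [f, Set.indicator_of_notMem h, mul_zero]
  have hInt : Integrable (fun r : ℝ => (1 + r) ^ 2) (E.measure x) := by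
    have h1 : Integrable (fun r : ℝ => r) (E.measure x) := by
      refine ((integrable_const (1 : ℝ)).add hx).mono' (by fun_prop)
        (Eventually.of_forall fun r => ?_)
      rw [Pi.add_apply, Real.norm_eq_abs, abs_le]
      constructor <;> nlinarith [sq_nonneg (r + 1), sq_nonneg (r - 1)]
    have := ((integrable_const (1 : ℝ)).add (h1.const_mul 2)).add hx
    exact this.congr (Eventually.of_forall fun r => by
      simp only [Pi.add_apply]; ring)
  have htail : Tendsto (fun n : ℕ => ∫ r in Set.Ici (n : ℝ), (1 + r) ^ 2 ∂(E.measure x)) atTop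
      (𝓝 0) := by
    have h := tendsto_setIntegral_of_antitone (μ := E.measure x) (f := fun r : ℝ => (1 + r) ^ 2)
      (s := fun n : ℕ => Set.Ici (n : ℝ)) (fun n => measurableSet_Ici)
      (fun n m h => Set.Ici_subset_Ici.mpr (by exact_mod_cast h)) ⟨0, hInt.integrableOn⟩
    have h0 : ⋂ n : ℕ, Set.Ici (n : ℝ) = ∅ := by
      refine Set.eq_empty_iff_forall_notMem.mpr fun r hr => ?_
      obtain ⟨n, hn⟩ := exists_nat_gt r
      exact absurd (Set.mem_iInter.mp hr n) (not_le.mpr hn)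
    rwa [h0, setIntegral_empty] at h
  have hdist (n m N : ℕ) (hn : N ≤ n) (hm : N ≤ m) :
      dist (U n x) (U m x) ≤ √(∫ r in Set.Ici (N : ℝ), (1 + r) ^ 2 ∂(E.measure x)) := by
    refine Real.le_sqrt_of_sq_le ?_
    have h1 := inner_map_map_eq_integral ((hf n).sub (hf m)) (c := (1 + n) + (1 + m))
      (fun r => (norm_sub_le _ _).trans (add_le_add (hfb n r) (hfb m r)))
      ((hU n).sub (hU m) (E.integrable_of_bounded (hf n) (hfb n))
        (E.integrable_of_bounded (hf m) (hfb m))) x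
    rw [integral_complex_ofReal, inner_self_eq_norm_sq_to_K] at h1
    have h2 : ‖(U n - U m) x‖ ^ 2 = ∫ r, ‖(f n - f m) r‖ ^ 2 ∂(E.measure x) := by
      exact Complex.ofReal_injective (by rw [← h1]; simp)
    rw [dist_eq_norm, ← sub_apply, h2, ← integral_indicator measurableSet_Ici]
    refine integral_mono_of_nonneg (Eventually.of_forall fun r => sq_nonneg _)
      (hInt.indicator measurableSet_Ici) (Eventually.of_forall fun r => ?_)
    have hnN : (N : ℝ) ≤ n := by exact_mod_cast hn
    have hmN : (N : ℝ) ≤ m := by exact_mod_cast hm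
    simp only [Pi.sub_apply, f, Set.indicator_apply, Set.mem_Icc, Set.mem_Ici]
    by_cases hr : (N : ℝ) ≤ r
    · rw [if_pos hr]
      have : ‖((1 + r : ℝ) : ℂ)‖ ^ 2 = (1 + r) ^ 2 := by
        rw [Complex.norm_real, Real.norm_eq_abs, sq_abs]
      split_ifs
      · simpa using sq_nonneg (1 + r)
      · rw [sub_zero, this]
      · rw [zero_sub, norm_neg, this]
      · simpa using sq_nonneg (1 + r)
    · rw [if_neg hr]
      have h3 : r ≤ n := by linarith
      have h4 : r ≤ m := by linarith
      simp [h3, h4]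
  have hcauchy : CauchySeq fun n => U n x :=
    cauchySeq_of_le_tendsto_0 _ hdist (by simpa using htail.sqrt)
  obtain ⟨y, hy⟩ := cauchySeq_tendsto_of_complete hcauchy
  refine ⟨y, ext_inner_left ℂ fun z => ?_⟩
  refine tendsto_nhds_unique ((tendsto_const_nhds (x := z)).inner
    ((C.continuous.tendsto y).comp hy)) ?_
  have := tendsto_inner_proj_Icc (measure_Iio_eq_zero hE hC) z x
  simp only [← hCU] at this
  exact this

end SpectralMeasure

namespace BoundedModularData

variable {V : StandardSubspace H} (d : BoundedModularData V) {E : SpectralMeasure H}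

theorem represents_of_isOperatorIntegral
    (hE : IsOperatorIntegral E.measure (fun r => (resolventFun r : ℂ)) (d.a * d.a)) :
    E.Represents (modularOperator V) := by
  have hC (x : H) (hx : (d.a * d.a) x = 0) : x = 0 := d.a_injective _ (d.a_injective _ hx)
  refine ⟨fun x => ⟨fun hx => ?_, fun hx => ?_⟩, fun x => ?_⟩
  · obtain ⟨q, rfl, -⟩ := d.apply_mem_graph hx
    exact SpectralMeasure.integrable_sq_of_isOperatorIntegral hE q
  · obtain ⟨y, rfl⟩ := SpectralMeasure.exists_apply_eq_of_integrable_sq hE hC hx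
    exact LinearPMap.mem_domain_of_mem_graph (d.mem_graph_modularOperator.mpr ⟨y, rfl, rfl⟩)
  · obtain ⟨q, hq, hq'⟩ := d.apply_mem_graph x.2
    have hi (x : H) := E.integrable_of_bounded measurable_ofReal_resolventFun
      norm_resolventFun_le x
    have h2 := SpectralMeasure.isOperatorIntegral_mul measurable_ofReal_resolventFun
      norm_resolventFun_le measurable_ofReal_resolventFun norm_resolventFun_le hE hE
    have hi2 (x : H) := E.integrable_of_bounded
      (measurable_ofReal_resolventFun.mul measurable_ofReal_resolventFun) (c := 1)
      (fun r => by
        rw [Pi.mul_apply, norm_mul]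
        exact mul_le_one₀ (norm_resolventFun_le r) (norm_nonneg _) (norm_resolventFun_le r)) x
    have h3 := (hE.sub h2 hi hi2) q
    change inner ℂ (x : H) (modularOperator V ⟨x, x.2⟩) = _
    have h4 : d.b (d.b q) = q - d.a (d.a q) := by
      rw [eq_sub_iff_add_eq, add_comm, d.sq_apply]
    have h5 : inner ℂ (d.a (d.a q)) (d.b (d.b q)) =
        inner ℂ q ((d.a * d.a - (d.a * d.a) * (d.a * d.a)) q) := by
      rw [d.inner_a, d.inner_a, h4, map_sub, map_sub]
      rfl
    rw [hq', hq, h5, h3]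
    change _ = ∫ r : ℝ, (r : ℂ) ∂(E.measure ((d.a * d.a) q))
    rw [SpectralMeasure.integral_measure_map measurable_ofReal_resolventFun
      norm_resolventFun_le hE]
    refine integral_congr_ae (Eventually.of_forall fun r => ?_)
    -- With `ρ = (1 + r)⁻¹`, the form of `a² - a⁴` at `q` integrates `ρ - ρ² = ρ² r`, and `ρ²` is
    -- the density of `μ_{a² q}` against `μ_q`.
    have h6 : resolventFun r - resolventFun r * resolventFun r =
        resolventFun r ^ 2 * r := by
      have h7 := mul_resolventFun r
      split_ifs at h7 with h8
      · linear_combination -(resolventFun r) * h7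
      · simp [resolventFun, h8]
    simp only [Pi.sub_apply, Complex.norm_real, Complex.real_smul, Real.norm_eq_abs, sq_abs]
    exact_mod_cast h6

end BoundedModularData

end StandardModular

/-! ### The unitaries `Δ_V^{it}` and their commutant -/

namespace StandardModular

open Filter Topology MeasureTheory NNReal

theorem ofReal_cpow_mul_I {r : ℝ} (hr : 0 < r) (t : ℝ) :
    (r : ℂ) ^ ((t : ℂ) * Complex.I) = Complex.exp (t * (Real.log r : ℝ) * Complex.I) := by
  rw [Complex.cpow_def_of_ne_zero (by exact_mod_cast hr.ne'), Complex.ofReal_log hr.le]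
  congr 1
  ring

theorem norm_ofReal_cpow_mul_I {r : ℝ} (hr : 0 < r) (t : ℝ) :
    ‖(r : ℂ) ^ ((t : ℂ) * Complex.I)‖ = 1 := by
  rw [Complex.norm_cpow_eq_rpow_re_of_pos hr]
  simp

theorem conj_ofReal_cpow_mul_I {r : ℝ} (hr : 0 < r) (t : ℝ) :
    starRingEnd ℂ ((r : ℂ) ^ ((t : ℂ) * Complex.I)) =
      (r : ℂ) ^ (((-t : ℝ) : ℂ) * Complex.I) := by
  rw [ofReal_cpow_mul_I hr, ofReal_cpow_mul_I hr, ← Complex.exp_conj]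
  simp

variable {H : Type*} [NormedAddCommGroup H] [InnerProductSpace ℂ H] [CompleteSpace H]

namespace BoundedModularData

variable {V : StandardSubspace H} (d : BoundedModularData V) {E : SpectralMeasure H}
include d

theorem exists_isOperatorIntegral_resolventFun : ∃ E : SpectralMeasure H,
    IsOperatorIntegral E.measure (fun r => (resolventFun r : ℂ)) (d.a * d.a) := by
  refine exists_spectralMeasure_resolvent
    (Commute.mul_nonneg d.a_nonneg d.a_nonneg (Commute.refl _)) ?_
  rw [← d.sq_add_sq]
  exact le_add_of_nonneg_right (Commute.mul_nonneg d.b_nonneg d.b_nonneg (Commute.refl _))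

theorem exists_isFunctionOf (t : ℝ) : ∃ U : H →L[ℂ] H,
    IsFunctionOf (modularOperator V) (fun r => (r : ℂ) ^ ((t : ℂ) * Complex.I)) U := by
  obtain ⟨E, hE⟩ := d.exists_isOperatorIntegral_resolventFun
  have hR := d.represents_of_isOperatorIntegral hE
  -- Cutting off at `0` gives the bound `1` everywhere; nothing changes almost everywhere, since the
  -- spectral measure lives on `(0, ∞)`.
  let f : ℝ → ℂ := (Set.Ioi 0).indicator fun r => (r : ℂ) ^ ((t : ℂ) * Complex.I)
  have hf : Measurable f := Measurable.indicator
    (Complex.measurable_ofReal.pow_const _) measurableSet_Ioi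
  have hfb (r : ℝ) : ‖f r‖ ≤ 1 := by
    by_cases h : 0 < r
    · simp only [f, Set.indicator_of_mem (Set.mem_Ioi.mpr h), norm_ofReal_cpow_mul_I h, le_refl]
    · simp [f, h]
  have hae (x : H) : f =ᵐ[E.measure x] fun r => (r : ℂ) ^ ((t : ℂ) * Complex.I) := by
    filter_upwards [d.ae_pos hR x] with r hr
    exact Set.indicator_of_mem hr _
  obtain ⟨U, hU⟩ := E.exists_isOperatorIntegral hf hfb
  exact ⟨U, E, hR, fun x => ⟨(E.integrable_of_bounded hf hfb x).congr (hae x),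
    (hU x).trans (integral_congr_ae (hae x))⟩⟩

/-- The definition of `modularUnitary` involves an arbitrary choice of spectral measure; uniqueness
makes the result independent of it. -/
theorem isOperatorIntegral_modularUnitary
    (hE : IsOperatorIntegral E.measure (fun r => (resolventFun r : ℂ)) (d.a * d.a)) (t : ℝ) :
    IsOperatorIntegral E.measure (fun r => (r : ℂ) ^ ((t : ℂ) * Complex.I))
      (modularUnitary V t) := by
  have h := d.exists_isFunctionOf t
  rw [modularUnitary, functionOf, dif_pos h]
  obtain ⟨E', hE', hU⟩ := h.choose_spec
  intro x
  rw [(hU x).2, SpectralMeasure.measure_eq (d.isOperatorIntegral_resolventFun hE') hE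
    fun x hx => d.a_injective _ (d.a_injective _ hx)]

theorem star_modularUnitary (t : ℝ) : star (modularUnitary V t) = modularUnitary V (-t) := by
  obtain ⟨E, hE⟩ := d.exists_isOperatorIntegral_resolventFun
  refine eq_of_quadratic_eq fun x => ?_
  rw [(d.isOperatorIntegral_modularUnitary hE t).conj x,
    d.isOperatorIntegral_modularUnitary hE (-t) x]
  refine integral_congr_ae ?_
  filter_upwards [d.ae_pos (d.represents_of_isOperatorIntegral hE) x] with r hr
  exact conj_ofReal_cpow_mul_I hr t

theorem commute_unitary_iff (g : unitary (H →L[ℂ] H)) :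
    Commute (g : H →L[ℂ] H) (d.a * d.a) ↔
      ∀ t, Commute (g : H →L[ℂ] H) (modularUnitary V t) := by
  obtain ⟨E, hE⟩ := d.exists_isOperatorIntegral_resolventFun
  have hpos (x : H) := d.ae_pos (d.represents_of_isOperatorIntegral hE) x
  constructor
  · intro hg t
    refine unitary_inner_comm.mpr fun x => ?_
    rw [d.isOperatorIntegral_modularUnitary hE t, d.isOperatorIntegral_modularUnitary hE t,
      SpectralMeasure.measure_unitary hE (fun x hx => d.a_injective _ (d.a_injective _ hx)) hg]
  · intro hg
    refine unitary_inner_comm.mpr fun x => ?_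
    rw [hE, hE]
    congr 1
    have hexp (x : H) : ((E.measure x).map Real.log).map Real.exp = E.measure x := by
      rw [Measure.map_map Real.measurable_exp Real.measurable_log]
      conv_rhs => rw [← Measure.map_id (μ := E.measure x)]
      refine Measure.map_congr ?_
      filter_upwards [hpos x] with r hr
      exact Real.exp_log hr
    -- As `r^{it} = e^{it log r}`, the forms of the `Δ_V^{it}` are the Fourier transform of the
    -- distribution of `log r`, which determines the measure.
    have hchar (x : H) (t : ℝ) : charFun ((E.measure x).map Real.log) t =
        inner ℂ x (modularUnitary V t x) := by
      rw [charFun_apply_real, integral_map Real.measurable_log.aemeasurable (by fun_prop),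
        d.isOperatorIntegral_modularUnitary hE t]
      refine integral_congr_ae ?_
      filter_upwards [hpos x] with r hr
      exact (ofReal_cpow_mul_I hr t).symm
    rw [← hexp x, ← hexp]
    congr 1
    refine Measure.ext_of_charFun (funext fun t => ?_)
    rw [hchar, hchar]
    exact unitary_inner_comm.mp (hg t) x

theorem commute_iff (A : H →L[ℂ] H) :
    Commute A (d.a * d.a) ↔ CommutesWithModularGroup A V := by
  constructor
  · intro hA t
    refine commute_of_forall_unitary (S := {d.a * d.a}) ?_ ?_ fun u hu =>
      (d.commute_unitary_iff u).mp (hu _ rfl) t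
    · rintro _ rfl
      exact (Commute.mul_nonneg d.a_nonneg d.a_nonneg (Commute.refl _)).isSelfAdjoint.star_eq
    · rintro _ rfl
      exact hA
  · intro hA
    refine commute_of_forall_unitary (S := Set.range (modularUnitary V)) ?_ ?_ fun u hu =>
      (d.commute_unitary_iff u).mpr fun t => hu _ ⟨t, rfl⟩
    · rintro _ ⟨t, rfl⟩
      exact ⟨-t, (d.star_modularUnitary t).symm⟩
    · rintro _ ⟨t, rfl⟩
      exact hA t

theorem commutesWithConjugation_iff (A : H →L[ℂ] H) :
    CommutesWithConjugation A V ↔ ∀ x, A (d.J x) = d.J (A x) := by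
  rw [CommutesWithConjugation, d.modularConjugation_eq]

end BoundedModularData

end StandardModular

/-! ### Unitary endomorphisms and the stabilizer -/

namespace StandardModular

variable {H : Type*} [NormedAddCommGroup H] [InnerProductSpace ℂ H]

theorem tomita_apply_of_preserves {V : StandardSubspace H} {A : H →L[ℂ] H} (hA : Preserves A V)
    {z : H} (h : z ∈ (tomita V).domain) :
    ∃ h' : A z ∈ (tomita V).domain, tomita V ⟨A z, h'⟩ = A (tomita V ⟨z, h⟩) := by
  obtain ⟨x, hx, y, hy, rfl⟩ := id h
  have h1 : A (x + Complex.I • y) = A x + Complex.I • A y := by rw [map_add, map_smul]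
  have h2 : A x + Complex.I • A y ∈ (tomita V).domain := ⟨_, hA x hx, _, hA y hy, rfl⟩
  refine ⟨h1 ▸ h2, ?_⟩
  rw [tomita_apply V hx hy, map_sub, map_smul, ← tomita_apply V (hA x hx) (hA y hy) h2]
  congr 2

variable [CompleteSpace H]

theorem unitary_apply_inv_apply (g : unitary (H →L[ℂ] H)) (x : H) :
    (g : H →L[ℂ] H) (((g⁻¹ : unitary (H →L[ℂ] H)) : H →L[ℂ] H) x) = x := by
  rw [← mul_apply_eq_comp, ← Submonoid.coe_mul, mul_inv_cancel]; rfl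

theorem unitary_inv_apply_apply (g : unitary (H →L[ℂ] H)) (x : H) :
    ((g⁻¹ : unitary (H →L[ℂ] H)) : H →L[ℂ] H) ((g : H →L[ℂ] H) x) = x := by
  rw [← mul_apply_eq_comp, ← Submonoid.coe_mul, inv_mul_cancel]; rfl

theorem inner_unitary_apply_left (g : unitary (H →L[ℂ] H)) (x y : H) :
    inner ℂ ((g : H →L[ℂ] H) x) y =
      inner ℂ x (((g⁻¹ : unitary (H →L[ℂ] H)) : H →L[ℂ] H) y) := by
  rw [← ContinuousLinearMap.adjoint_inner_right, ← ContinuousLinearMap.star_eq_adjoint]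
  rfl

theorem mem_unitaryStabilizer_iff {V : StandardSubspace H} {g : unitary (H →L[ℂ] H)} :
    g ∈ unitaryStabilizer V ↔ g ∈ unitaryEndomorphisms V ∧ g⁻¹ ∈ unitaryEndomorphisms V := by
  constructor
  · intro h
    refine ⟨fun x hx => ?_, fun x hx => ?_⟩
    · exact h.subset ⟨x, hx, rfl⟩
    · obtain ⟨y, hy, rfl⟩ := h.symm.subset hx
      exact (unitary_inv_apply_apply g y).symm ▸ hy
  · rintro ⟨h, h'⟩
    refine Set.Subset.antisymm ?_ fun x hx => ⟨_, h' x hx, unitary_apply_inv_apply g x⟩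
    rintro _ ⟨x, hx, rfl⟩
    exact h x hx

theorem unitaryStabilizer_eq_range_units (V : StandardSubspace H) :
    unitaryStabilizer V = Set.range (fun u : (unitaryEndomorphisms V)ˣ =>
      ((u : unitaryEndomorphisms V) : unitary (H →L[ℂ] H))) := by
  ext g
  rw [mem_unitaryStabilizer_iff]
  constructor
  · rintro ⟨h, h'⟩
    exact ⟨⟨⟨g, h⟩, ⟨g⁻¹, h'⟩, Subtype.ext (mul_inv_cancel g), Subtype.ext (inv_mul_cancel g)⟩, rfl⟩
  · rintro ⟨u, rfl⟩
    refine ⟨(u : unitaryEndomorphisms V).2, ?_⟩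
    have h : ((u : unitaryEndomorphisms V) : unitary (H →L[ℂ] H))⁻¹ =
        ((u⁻¹ : (unitaryEndomorphisms V)ˣ) : unitaryEndomorphisms V) :=
      inv_eq_of_mul_eq_one_right (congrArg Subtype.val u.mul_inv)
    rw [h]
    exact ((u⁻¹ : (unitaryEndomorphisms V)ˣ) : unitaryEndomorphisms V).2

namespace BoundedModularData

variable {V : StandardSubspace H} (d : BoundedModularData V) {g : unitary (H →L[ℂ] H)}
include d

/-- Since `g` and `g⁻¹` commute with the Tomita operator, `g` commutes with its adjoint as well. So
`g` maps `(a² y, b² y)` to some `(a² q, b² q)`, and adding the coordinates gives `q = g y`. -/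
theorem commute_of_mem_unitaryStabilizer (hg : g ∈ unitaryStabilizer V) :
    Commute (g : H →L[ℂ] H) (d.a * d.a) := by
  obtain ⟨h, h'⟩ := mem_unitaryStabilizer_iff.mp hg
  ext y
  have hD (y : H) : d.a y ∈ (tomita V).domain := d.mem_complexSpan_iff_exists.mpr ⟨y, rfl⟩
  obtain ⟨h1, h2⟩ := tomita_apply_of_preserves h (hD (d.a y))
  obtain ⟨p, hp⟩ := d.mem_complexSpan_iff_exists.mp h1
  have h3 : tomita V ⟨d.a p, hD p⟩ = (g : H →L[ℂ] H) (tomita V ⟨d.a (d.a y), hD (d.a y)⟩) := by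
    rw [← h2]
    congr 2
    exact hp.symm
  rw [d.tomita_a, d.tomita_a] at h3
  have h4 := d.antiAdjoint_tomita_iff.mpr ⟨d.b y, (by rw [d.J_J, d.a_b] :
    d.J (d.J (d.b (d.a y))) = d.a (d.b y)), rfl⟩
  obtain ⟨y', hy', hb⟩ := d.antiAdjoint_tomita_iff (u := (g : H →L[ℂ] H) (d.J (d.b (d.a y))))
    (w := (g : H →L[ℂ] H) (d.b (d.b y))) |>.mp fun z => by
      obtain ⟨h5, h6⟩ := tomita_apply_of_preserves h' z.2
      have h7 := h4 ⟨_, h5⟩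
      rw [h6] at h7
      rw [inner_unitary_apply_left, h7, ← inner_conj_symm,
        ← inner_conj_symm _ ((g : H →L[ℂ] H) _), inner_unitary_apply_left]
  rw [← h3, d.J_J] at hy'
  obtain ⟨q, rfl, rfl⟩ := d.exists_of_b_eq_a hy'
  have hq : (g : H →L[ℂ] H) y = q := by
    rw [← d.sq_apply y, map_add, hp, hb, d.sq_apply]
  change (g : H →L[ℂ] H) (d.a (d.a y)) = d.a (d.a ((g : H →L[ℂ] H) y))
  rw [hp, hq]

/-- Commuting with `a²` and preserving `V` force commuting with `J`. Both relations pass to `g⁻¹`,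
which therefore preserves `V` too. -/
theorem mem_unitaryStabilizer_of_commute (h : Commute (g : H →L[ℂ] H) (d.a * d.a))
    (hV : g ∈ unitaryEndomorphisms V) : g ∈ unitaryStabilizer V := by
  refine mem_unitaryStabilizer_iff.mpr ⟨hV, d.preserves_of_commute ?_ fun x => ?_⟩
  · ext x
    have h1 := DFunLike.congr_fun h.eq (((g⁻¹ : unitary (H →L[ℂ] H)) : H →L[ℂ] H) x)
    simp only [mul_apply_eq_comp, unitary_apply_inv_apply] at h1
    simp only [mul_apply_eq_comp, ← h1, unitary_inv_apply_apply]
  · have h1 := d.J_comm_of_preserves h hV (((g⁻¹ : unitary (H →L[ℂ] H)) : H →L[ℂ] H) x)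
    rw [unitary_apply_inv_apply] at h1
    rw [← h1, unitary_inv_apply_apply]

theorem unitary_conj_J_eq_iff : (∀ x : H, (g : H →L[ℂ] H) (modularConjugation V
      (((g⁻¹ : unitary (H →L[ℂ] H)) : H →L[ℂ] H) x)) = modularConjugation V x) ↔
    ∀ x, (g : H →L[ℂ] H) (d.J x) = d.J ((g : H →L[ℂ] H) x) := by
  rw [d.modularConjugation_eq]
  constructor
  · intro h x
    rw [← h ((g : H →L[ℂ] H) x), unitary_inv_apply_apply]
  · intro h x
    rw [h, unitary_apply_inv_apply]

end BoundedModularData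

end StandardModular

/-! ### The main theorem -/

open StandardModular in
theorem corollary2p4 {H : Type*} [NormedAddCommGroup H] [InnerProductSpace ℂ H]
    [CompleteSpace H] (V : StandardSubspace H) :
    (∀ A : H →L[ℂ] H,
      [Preserves A V ∧ CommutesWithModularGroup A V,
       Preserves A V ∧ CommutesWithConjugation A V,
       CommutesWithConjugation A V ∧ CommutesWithModularGroup A V].TFAE) ∧
    unitaryStabilizer V =
      Set.range (fun u : (unitaryEndomorphisms V)ˣ =>
        ((u : unitaryEndomorphisms V) : unitary (H →L[ℂ] H))) ∧
    unitaryStabilizer V =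
      {g | g ∈ unitaryEndomorphisms V ∧
        unitaryConj g (modularOperator V) = modularOperator V} ∧
    unitaryStabilizer V =
      {g | g ∈ unitaryEndomorphisms V ∧
        ∀ x : H, (g : H →L[ℂ] H) (modularConjugation V
          (((g⁻¹ : unitary (H →L[ℂ] H)) : H →L[ℂ] H) x)) = modularConjugation V x} := by
  obtain ⟨d⟩ := nonempty_boundedModularData V
  refine ⟨fun A => ?_, unitaryStabilizer_eq_range_units V, ?_, ?_⟩
  · simp only [← d.commute_iff, d.commutesWithConjugation_iff]
    tfae_have 1 → 2 := fun ⟨hV, h⟩ => ⟨hV, d.J_comm_of_preserves h hV⟩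
    tfae_have 2 → 3 := fun ⟨hV, hJ⟩ => ⟨hJ, d.commute_of_preserves hV hJ⟩
    tfae_have 3 → 1 := fun ⟨hJ, h⟩ => ⟨d.preserves_of_commute h hJ, h⟩
    tfae_finish
  · ext g
    rw [Set.mem_ofPred_eq, d.unitaryConj_modularOperator_eq_iff]
    exact ⟨fun hg => ⟨(mem_unitaryStabilizer_iff.mp hg).1, d.commute_of_mem_unitaryStabilizer hg⟩,
      fun ⟨hV, h⟩ => d.mem_unitaryStabilizer_of_commute h hV⟩
  · ext g
    rw [Set.mem_ofPred_eq, d.unitary_conj_J_eq_iff]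
    refine ⟨fun hg => ?_, fun ⟨hV, hJ⟩ =>
      d.mem_unitaryStabilizer_of_commute (d.commute_of_preserves hV hJ) hV⟩
    have hV := (mem_unitaryStabilizer_iff.mp hg).1
    exact ⟨hV, d.J_comm_of_preserves (d.commute_of_mem_unitaryStabilizer hg) hV⟩
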